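/- Let $(X,d)$ be a complete metric space with a nontrivial Borel regular measure $\mu$ such that $0<\mu(U)<\infty$ for every nonempty bounded open set $U\subset X$. Let $1<p<\infty$ and $1\le q\le\infty$. For a measurable $f:X\to[-\infty,\infty]$ let $f^*(t)=\inf\{v\ge 0:\mu(\{|f|>v\})\le t\}$ and let $$\|f\|_{L^{p,q}}=\Big(\int_0^\infty (t^{1/p}f^*(t))^q\,\frac{dt}{t}\Big)^{1/q}\ (q<\infty),\qquad \|f\|_{L^{p,\infty}}=\sup_{t>0}t\,\mu(\{|f|>t\})^{1/p}.$$ Let $\Gamma_{\rm rect}$ be the family of all nonconstant rectifiable curves in $X$, each parametrized by arc length as $\gamma:[0,\ell(\gamma)]\to X$. The $p,q$-modulus of $\Gamma\subset\Gamma_{\rm rect}$ is $\mathrm{Mod}_{p,q}(\Gamma)=\inf\|\rho\|_{L^{p,q}}^p$, the infimum being over all Borel $\rho:X\to[0,\infty]$ with $\int_\gamma\rho\,ds\ge 1$ for every $\gamma\in\Gamma$. A Borel function $g:X\to[0,\infty]$ is a $p,q$-weak upper gradient of a Borel function $u:X\to[-\infty,\infty]$ if, for all $\gamma\in\Gamma_{\rm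 rect}$ outside a family of $p,q$-modulus zero, $|u(\gamma(0))-u(\gamma(\ell(\gamma)))|\le\int_\gamma g\,ds$ when both $u(\gamma(0))$ and $u(\gamma(\ell(\gamma)))$ are finite, and $\int_\gamma g\,ds=\infty$ otherwise. Let $N^{1,L^{p,q}}$ be the set of all Borel functions $u$ with $\|u\|_{L^{p,q}}<\infty$ that have a $p,q$-weak upper gradient $g$ with $\|g\|_{L^{p,q}}<\infty$, and put $$\|u\|_{N^{1,L^{p,q}}}=\big(\|u\|_{L^{p,q}}^r+\inf_g\|g\|_{L^{p,q}}^r\big)^{1/r},\qquad r=q\ \text{if}\ q\le p,\quad r=p\ \text{if}\ q>p,$$ the infimum being over all $p,q$-weak upper gradients $g$ of $u$ with $\|g\|_{L^{p,q}}<\infty$. For an arbitrary set $E\subset X$ the Sobolev–Lorentz capacity is $$\mathrm{Cap}_{p,q}(E)=\inf\{\|u\|_{N^{1,L^{p,q}}}^p: u\in N^{1,L^{p,q}},\ u\ge 1\text{ on }E\}\in[0,\infty],\qquad \inf\emptyset=\infty.$$ The measure $\mu$ is called nonatomic if every measurable set $A$ with $\mu(A)>0$ contains a measurable set $B$ with $0<\mu(B)<\mu(A)$.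 **Theorem.** The set function $E\mapsto\mathrm{Cap}_{p,q}(E)$, $E\subset X$, has the following properties. (i) If $E_1\subset E_2$, then $\mathrm{Cap}_{p,q}(E_1)\le\mathrm{Cap}_{p,q}(E_2)$. (ii) If $\mu$ is nonatomic and $1<q\le p$, then for all sets $E_1\subset E_2\subset\cdots\subset E=\bigcup_{i\ge1}E_i\subset X$ we have $\mathrm{Cap}_{p,q}(E)=\lim_{i\to\infty}\mathrm{Cap}_{p,q}(E_i)$. (iii) If $p<q\le\infty$, then for all sets $E=\bigcup_{i\ge1}E_i\subset X$ we have $\mathrm{Cap}_{p,q}(E)\le\sum_{i\ge1}\mathrm{Cap}_{p,q}(E_i)$. (iv) If $1\le q\le p$, then for all sets $E=\bigcup_{i\ge1}E_i\subset X$ we have $\mathrm{Cap}_{p,q}(E)^{q/p}\le\sum_{i\ge1}\mathrm{Cap}_{p,q}(E_i)^{q/p}$. -/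

import Mathlib

open MeasureTheory Set Filter Topology
open scoped ENNReal NNReal

namespace SobolevLorentz

noncomputable section

/-- The nonincreasing rearrangement `f*(t) = inf {v : μ {x : f x > v} ≤ t}` of a `[0, ∞]`-valued
function. (The value `v = ∞` is always admitted, which encodes `inf ∅ = ∞`.) -/
def rearrangement {X : Type*} [MeasurableSpace X] (μ : Measure X) (f : X → ℝ≥0∞) (t : ℝ) : ℝ≥0∞ :=
  sInf {v : ℝ≥0∞ | μ {x | v < f x} ≤ ENNReal.ofReal t}

/-- The Lorentz `p,q`-(quasi)norm of a `[0, ∞]`-valued function: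
`(∫₀^∞ (t^{1/p} f*(t))^q dt/t)^{1/q}` if `q < ∞`, and `sup_{t > 0} t μ{f > t}^{1/p}` if `q = ∞`. -/
def lorentzNorm {X : Type*} [MeasurableSpace X] (p : ℝ) (q : ℝ≥0∞) (μ : Measure X)
    (f : X → ℝ≥0∞) : ℝ≥0∞ :=
  if q = ∞ then
    ⨆ (t : ℝ≥0) (_ : 0 < t), (t : ℝ≥0∞) * (μ {x | (t : ℝ≥0∞) < f x}) ^ (1 / p)
  else
    (∫⁻ t in Ioi (0 : ℝ),
      (ENNReal.ofReal t ^ (1 / p) * rearrangement μ f t) ^ q.toReal / ENNReal.ofReal t)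
        ^ (1 / q.toReal)

/-- The pointwise absolute value of an extended real valued function. -/
def absFun {X : Type*} (u : X → EReal) : X → ℝ≥0∞ := fun x => (u x).abs

/-- A nonconstant rectifiable curve in `X`, given by its arc length parametrization
`γ : [0, ℓ] → X`, where `ℓ > 0` is the length of the curve. Unit speed says that the length of
`γ` restricted to `[s, t]` is `t - s`, for all `0 ≤ s ≤ t ≤ ℓ`; so `γ` is continuous.
Only the values on `[0, ℓ]` are ever used. -/
structure RectifiableCurve (X : Type*) [MetricSpace X] where
  /-- the arc length parametrization -/
  toFun : ℝ → X
  /-- the length -/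
  length : ℝ
  length_pos : 0 < length
  unitSpeed : HasUnitSpeedOn toFun (Icc 0 length)

/-- The integral `∫_γ ρ = ∫₀^ℓ ρ(γ(s)) ds`. -/
def curveIntegral {X : Type*} [MetricSpace X] (γ : RectifiableCurve X) (ρ : X → ℝ≥0∞) : ℝ≥0∞ :=
  ∫⁻ s in Icc (0 : ℝ) γ.length, ρ (γ.toFun s)

/-- The `p,q`-modulus of a family of nonconstant rectifiable curves. -/
def pqModulus {X : Type*} [MetricSpace X] [MeasurableSpace X] (p : ℝ) (q : ℝ≥0∞) (μ : Measure X)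
    (Γ : Set (RectifiableCurve X)) : ℝ≥0∞ :=
  ⨅ (ρ : X → ℝ≥0∞) (_ : Measurable ρ) (_ : ∀ γ ∈ Γ, 1 ≤ curveIntegral γ ρ),
    lorentzNorm p q μ ρ ^ p

/-- The upper gradient inequality for `u` and `g` on the curve `γ`:
`|u(γ(0)) - u(γ(ℓ))| ≤ ∫_γ g` if both values of `u` are finite, and `∫_γ g = ∞` otherwise. -/
def UpperGradientOn {X : Type*} [MetricSpace X] (u : X → EReal) (g : X → ℝ≥0∞)
    (γ : RectifiableCurve X) : Prop :=
  if (u (γ.toFun 0)).abs < ∞ ∧ (u (γ.toFun γ.length)).abs < ∞ then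
    (u (γ.toFun 0) - u (γ.toFun γ.length)).abs ≤ curveIntegral γ g
  else
    curveIntegral γ g = ∞

/-- The Borel function `g` is a `p,q`-weak upper gradient of `u`: the upper gradient inequality
holds on all nonconstant rectifiable curves outside a family of `p,q`-modulus zero. -/
def IsWeakUpperGradient {X : Type*} [MetricSpace X] [MeasurableSpace X] (p : ℝ) (q : ℝ≥0∞)
    (μ : Measure X) (u : X → EReal) (g : X → ℝ≥0∞) : Prop :=
  Measurable g ∧ pqModulus p q μ {γ | ¬ UpperGradientOn u g γ} = 0

/-- The space of all Borel functions `u : X → [-∞, ∞]` in `L^{p,q}(X, μ)` that have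
a `p,q`-weak upper gradient in `L^{p,q}(X, μ)`. -/
def newtonianSpace {X : Type*} [MetricSpace X] [MeasurableSpace X] (p : ℝ) (q : ℝ≥0∞)
    (μ : Measure X) : Set (X → EReal) :=
  {u | Measurable u ∧ lorentzNorm p q μ (absFun u) < ∞ ∧
    ∃ g : X → ℝ≥0∞, IsWeakUpperGradient p q μ u g ∧ lorentzNorm p q μ g < ∞}

/-- The Newtonian (quasi)norm `(‖u‖^r + inf_g ‖g‖^r)^{1/r}`, with `r = q` if `q ≤ p` and `r = p` if
`q > p`; the infimum is over all `p,q`-integrable `p,q`-weak upper gradients `g` of `u`. -/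
def newtonianNorm {X : Type*} [MetricSpace X] [MeasurableSpace X] (p : ℝ) (q : ℝ≥0∞)
    (μ : Measure X) (u : X → EReal) : ℝ≥0∞ :=
  if q ≤ ENNReal.ofReal p then
    (lorentzNorm p q μ (absFun u) ^ q.toReal +
      ⨅ (g : X → ℝ≥0∞) (_ : IsWeakUpperGradient p q μ u g) (_ : lorentzNorm p q μ g < ∞),
        lorentzNorm p q μ g ^ q.toReal) ^ (1 / q.toReal)
  else
    (lorentzNorm p q μ (absFun u) ^ p +
      ⨅ (g : X → ℝ≥0∞) (_ : IsWeakUpperGradient p q μ u g) (_ : lorentzNorm p q μ g < ∞),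
        lorentzNorm p q μ g ^ p) ^ (1 / p)

/-- The admissible functions for `E`: functions in the Newtonian space with `u ≥ 1` on `E`. -/
def admissible {X : Type*} [MetricSpace X] [MeasurableSpace X] (p : ℝ) (q : ℝ≥0∞)
    (μ : Measure X) (E : Set X) : Set (X → EReal) :=
  {u | u ∈ newtonianSpace p q μ ∧ ∀ x ∈ E, 1 ≤ u x}

/-- The Sobolev–Lorentz `p,q`-capacity of an arbitrary set `E` (`∞` if nothing is admissible). -/
def capacity {X : Type*} [MetricSpace X] [MeasurableSpace X] (p : ℝ) (q : ℝ≥0∞)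
    (μ : Measure X) (E : Set X) : ℝ≥0∞ :=
  ⨅ u ∈ admissible p q μ E, newtonianNorm p q μ u ^ p

/-- `μ` is nonatomic: every measurable set of positive measure contains a measurable set of
strictly smaller positive measure. -/
def IsNonatomic {X : Type*} [MeasurableSpace X] (μ : Measure X) : Prop :=
  ∀ A : Set X, MeasurableSet A → 0 < μ A →
    ∃ B : Set X, B ⊆ A ∧ MeasurableSet B ∧ 0 < μ B ∧ μ B < μ A

end

end SobolevLorentz

namespace SobolevLorentz

/-! Let `s = q.toReal`. For finite `q`, Fubini turns the Lorentz norm into a Choquet integral: with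
`θ = s / p`, `‖f‖^s = θ⁻¹ ∫₀^∞ μ{f^s > τ}^θ dτ`. If `q ≤ p` then `θ ≤ 1`, and this integral is
countably subadditive in `f^s` (`choquet_tsum_le`). Indeed `x^θ` is a positive mixture of the
truncations `min x a`, and `∫ min (μ{k > τ}) a dτ` is the minimum over `b ≥ 0` of `a b + ∫ (k - b)₊
dμ`, an expression that is visibly subadditive. If `q > p`, the quantity `‖f‖^p` of a supremum is
countably subadditive by Minkowski's inequality in `L^{q/p}`, or directly when `q = ∞`. In both
cases `‖sup f_i‖^r ≤ ∑ ‖f_i‖^r` for the exponent `r` of the Newtonian norm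
(`lorentzNorm_iSup_rpow_le`).

Since the supremum of weak upper gradients is a weak upper gradient of the supremum
(`IsGradientPair.iSup`), suprema of almost optimal functions give the countable subadditivity of the
capacity.

Continuity along increasing sets uses uniform-convexity estimates in place of weak compactness. Let
`u_i` with gradient `g_i` be almost optimal for `E_i`. For `i ≤ j` the midpoint of `u_i` and `u_j`
is still admissible for `E_i`, so its energy is nearly maximal. The lower estimate `choquet_add_ge`
then forces the convexity deficit `(u_i^s + u_j^s)/2 - ((u_i + u_j)/2)^s` to have small Choquet
integral, and likewise for the gradients. As `s > 1`, the deficit controls `(u_j^s - u_i^s)₊` up to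
a small multiple of the energy. Along a sparse subsequence these positive parts are summable, so the
suprema of the functions and of the gradients cost hardly more than the first term, and they are
admissible for the union. -/

/-- The distribution function of `k`. -/
noncomputable def distribution {X : Type*} [MeasurableSpace X] (μ : Measure X) (k : X → ℝ≥0∞)
    (τ : ℝ) : ℝ≥0∞ :=
  μ {x | ENNReal.ofReal τ < k x}

/-- The Choquet integral of `k` with respect to the set function `A ↦ μ A ^ θ`. -/
noncomputable def choquet {X : Type*} [MeasurableSpace X] (μ : Measure X) (θ : ℝ)
    (k : X → ℝ≥0∞) : ℝ≥0∞ :=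
  ∫⁻ τ in Ioi (0 : ℝ), distribution μ k τ ^ θ

/-! ### Distribution functions and their truncated integrals -/

section Distribution

variable {X : Type*} [MeasurableSpace X] {μ : Measure X}

lemma distribution_antitone (k : X → ℝ≥0∞) : Antitone (distribution μ k) := fun _ _ h =>
  measure_mono fun _ hx => (ENNReal.ofReal_le_ofReal h).trans_lt hx

lemma measurable_distribution (k : X → ℝ≥0∞) : Measurable (distribution μ k) :=
  (distribution_antitone k).measurable

lemma distribution_mono {k l : X → ℝ≥0∞} (h : ∀ x, k x ≤ l x) (τ : ℝ) :
    distribution μ k τ ≤ distribution μ l τ :=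
  measure_mono fun x hx => lt_of_lt_of_le hx (h x)

lemma choquet_mono {θ : ℝ} (hθ : 0 ≤ θ) {k l : X → ℝ≥0∞} (h : ∀ x, k x ≤ l x) :
    choquet μ θ k ≤ choquet μ θ l :=
  lintegral_mono fun τ => ENNReal.rpow_le_rpow (distribution_mono h τ) hθ

lemma lintegral_indicator_ofReal_lt (y : ℝ≥0∞) :
    ∫⁻ τ in Ioi (0 : ℝ), {τ : ℝ | ENNReal.ofReal τ < y}.indicator 1 τ = y := by
  have hm : MeasurableSet {τ : ℝ | ENNReal.ofReal τ < y} :=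
    measurableSet_lt ENNReal.measurable_ofReal measurable_const
  rw [lintegral_indicator_one hm, Measure.restrict_apply hm]
  rcases eq_or_ne y ∞ with rfl | hy
  · have : {τ : ℝ | ENNReal.ofReal τ < ∞} ∩ Ioi 0 = Ioi 0 := by
      ext τ; simp
    rw [this, Real.volume_Ioi]
  · have : {τ : ℝ | ENNReal.ofReal τ < y} ∩ Ioi 0 = Ioo 0 y.toReal := by
      ext τ
      simp only [mem_inter_iff, mem_ofPred_eq, mem_Ioi, mem_Ioo]
      constructor
      · rintro ⟨h1, h2⟩
        exact ⟨h2, (ENNReal.ofReal_lt_iff_lt_toReal h2.le hy).1 h1⟩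
      · rintro ⟨h1, h2⟩
        exact ⟨(ENNReal.ofReal_lt_iff_lt_toReal h1.le hy).2 h2, h1⟩
    rw [this, Real.volume_Ioo, sub_zero, ENNReal.ofReal_toReal hy]

lemma lintegral_eq_lintegral_distribution [SFinite μ] {k : X → ℝ≥0∞} (hk : Measurable k) :
    ∫⁻ x, k x ∂μ = ∫⁻ τ in Ioi (0 : ℝ), distribution μ k τ := by
  have hm : MeasurableSet {z : X × ℝ | ENNReal.ofReal z.2 < k z.1} :=
    measurableSet_lt (ENNReal.measurable_ofReal.comp measurable_snd) (hk.comp measurable_fst)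
  calc ∫⁻ x, k x ∂μ
      = ∫⁻ x, (∫⁻ τ in Ioi (0 : ℝ),
          {z : X × ℝ | ENNReal.ofReal z.2 < k z.1}.indicator 1 (x, τ)) ∂μ := by
        refine lintegral_congr fun x => ?_
        exact (lintegral_indicator_ofReal_lt (k x)).symm
    _ = ∫⁻ τ in Ioi (0 : ℝ), ∫⁻ x, {z : X × ℝ | ENNReal.ofReal z.2 < k z.1}.indicator 1 (x, τ)
          ∂μ :=
        lintegral_lintegral_swap
          (f := fun x τ => {z : X × ℝ | ENNReal.ofReal z.2 < k z.1}.indicator 1 (x, τ))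
          ((measurable_one.indicator hm).aemeasurable)
    _ = _ := by
        refine lintegral_congr fun τ => ?_
        have : MeasurableSet {x | ENNReal.ofReal τ < k x} :=
          measurableSet_lt measurable_const hk
        rw [distribution, ← lintegral_indicator_one this]
        rfl

lemma choquet_one [SFinite μ] {k : X → ℝ≥0∞} (hk : Measurable k) :
    choquet μ 1 k = ∫⁻ x, k x ∂μ := by
  simp [choquet, lintegral_eq_lintegral_distribution hk]

lemma distribution_tsub (k : X → ℝ≥0∞) {b : ℝ} (hb : 0 ≤ b) {τ : ℝ} (hτ : 0 ≤ τ) :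
    distribution μ (fun x => k x - ENNReal.ofReal b) τ = distribution μ k (τ + b) := by
  simp only [distribution, lt_tsub_iff_right, ENNReal.ofReal_add hτ hb]

lemma lintegral_tsub_eq [SFinite μ] {k : X → ℝ≥0∞} (hk : Measurable k) {b : ℝ} (hb : 0 ≤ b) :
    ∫⁻ x, (k x - ENNReal.ofReal b) ∂μ = ∫⁻ τ in Ioi b, distribution μ k τ := by
  rw [lintegral_eq_lintegral_distribution (hk.sub_const _)]
  have h1 : ∫⁻ τ in Ioi (0 : ℝ), distribution μ (fun x => k x - ENNReal.ofReal b) τ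
      = ∫⁻ τ in Ioi (0 : ℝ), distribution μ k (τ + b) :=
    setLIntegral_congr_fun measurableSet_Ioi fun τ hτ =>
      distribution_tsub k hb (le_of_lt hτ)
  rw [h1]
  have h2 := (measurePreserving_add_right (volume : Measure ℝ) b).setLIntegral_comp_preimage
    (measurableSet_Ioi (a := b)) (measurable_distribution (μ := μ) k)
  rw [← h2]
  congr 2
  ext τ; simp

lemma lintegral_min_le (F : ℝ → ℝ≥0∞) (a : ℝ≥0∞) {b : ℝ} (hb : 0 ≤ b) :
    ∫⁻ τ in Ioi (0 : ℝ), min (F τ) a ≤ a * ENNReal.ofReal b + ∫⁻ τ in Ioi b, F τ := by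
  rw [← Ioc_union_Ioi_eq_Ioi hb]
  refine (lintegral_union_le _ _ _).trans (add_le_add ?_ (lintegral_mono fun τ => min_le_left _ _))
  calc ∫⁻ τ in Ioc 0 b, min (F τ) a ≤ ∫⁻ τ in Ioc 0 b, a := lintegral_mono fun τ => min_le_right _ _
    _ = _ := by simp

/-- The bound of `lintegral_min_le` is attained at the level where the decreasing `F` crosses `a`:
before it the minimum is `a`, after it the minimum is `F`. Hence the truncated integral is a minimum
over `b`. -/
lemma exists_lintegral_min_eq {F : ℝ → ℝ≥0∞} (hF : Antitone F) {a : ℝ≥0∞} (ha : a ≠ 0)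
    (hfin : ∫⁻ τ in Ioi (0 : ℝ), min (F τ) a ≠ ∞) :
    ∃ b : ℝ, 0 ≤ b ∧
      a * ENNReal.ofReal b + ∫⁻ τ in Ioi b, F τ ≤ ∫⁻ τ in Ioi (0 : ℝ), min (F τ) a := by
  set S : Set ℝ := {τ | 0 ≤ τ ∧ F τ ≤ a}
  -- If `F` exceeded `a` on the whole half-line, the truncated integral would be infinite.
  have hne : S.Nonempty := by
    by_contra h
    rw [Set.not_nonempty_iff_eq_empty, Set.eq_empty_iff_forall_notMem] at h
    apply hfin
    have : ∫⁻ τ in Ioi (0 : ℝ), min (F τ) a = ∫⁻ τ in Ioi (0 : ℝ), a :=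
      setLIntegral_congr_fun measurableSet_Ioi fun τ hτ => by
        refine min_eq_right (le_of_lt ?_)
        by_contra h'
        exact h τ ⟨le_of_lt hτ, not_lt.1 h'⟩
    rw [this]
    simp [ha]
  have hbdd : BddBelow S := ⟨0, fun τ h => h.1⟩
  refine ⟨sInf S, Real.sInf_nonneg fun τ h => h.1, ?_⟩
  set b := sInf S
  have hb : 0 ≤ b := Real.sInf_nonneg fun τ h => h.1
  have hU : Ioi (0 : ℝ) = Ioc 0 b ∪ Ioi b := (Ioc_union_Ioi_eq_Ioi hb).symm
  rw [hU, lintegral_union measurableSet_Ioi (by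
    rw [Set.disjoint_left]; rintro x ⟨_, h1⟩ h2; exact absurd h2 (not_lt.2 h1))]
  refine add_le_add ?_ ?_
  · calc a * ENNReal.ofReal b = ∫⁻ τ in Ioo 0 b, a := by simp
      _ ≤ ∫⁻ τ in Ioo 0 b, min (F τ) a := by
        refine setLIntegral_mono' measurableSet_Ioo fun τ hτ => ?_
        refine le_min (le_of_lt ?_) le_rfl
        by_contra h'
        exact absurd (csInf_le hbdd ⟨hτ.1.le, not_lt.1 h'⟩) (not_le.2 hτ.2)
      _ ≤ _ := lintegral_mono_set Ioo_subset_Ioc_self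
  · refine setLIntegral_mono' measurableSet_Ioi fun τ hτ => ?_
    obtain ⟨s, hs, hsτ⟩ := exists_lt_of_csInf_lt hne hτ
    exact le_min le_rfl ((hF hsτ.le).trans hs.2)

/-- Take the optimal level `b i` for each `k i` and test the sum at the level `∑ b i`, using `(∑ k i
- ∑ b i)₊ ≤ ∑ (k i - b i)₊`. -/
lemma lintegral_min_distribution_tsum_le [SFinite μ] {k : ℕ → X → ℝ≥0∞}
    (hk : ∀ i, Measurable (k i)) {a : ℝ≥0∞} (ha : a ≠ 0) :
    ∫⁻ τ in Ioi (0 : ℝ), min (distribution μ (fun x => ∑' i, k i x) τ) a ≤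
      ∑' i, ∫⁻ τ in Ioi (0 : ℝ), min (distribution μ (k i) τ) a := by
  by_cases hfin : ∑' i, ∫⁻ τ in Ioi (0 : ℝ), min (distribution μ (k i) τ) a = ∞
  · rw [hfin]; exact le_top
  choose b hb hle using fun i => exists_lintegral_min_eq (distribution_antitone (μ := μ) (k i)) ha
    (ENNReal.ne_top_of_tsum_ne_top hfin i)
  have hsum : ∑' i, ENNReal.ofReal (b i) ≠ ∞ := by
    intro h
    apply hfin
    rw [eq_top_iff]
    calc ∞ = a * ∑' i, ENNReal.ofReal (b i) := by rw [h, ENNReal.mul_top ha]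
      _ = ∑' i, a * ENNReal.ofReal (b i) := ENNReal.tsum_mul_left.symm
      _ ≤ _ := ENNReal.tsum_le_tsum fun i => le_self_add.trans (hle i)
  set B := ∑' i, ENNReal.ofReal (b i)
  have hB : ENNReal.ofReal B.toReal = B := ENNReal.ofReal_toReal hsum
  refine (lintegral_min_le _ a (ENNReal.toReal_nonneg (a := B))).trans ?_
  rw [hB, ← lintegral_tsub_eq (Measurable.tsum hk) ENNReal.toReal_nonneg, hB]
  calc a * B + ∫⁻ x, (∑' i, k i x - B) ∂μ
      ≤ a * B + ∫⁻ x, ∑' i, (k i x - ENNReal.ofReal (b i)) ∂μ := by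
        gcongr with x
        rw [tsub_le_iff_right, ← ENNReal.tsum_add]
        exact ENNReal.tsum_le_tsum fun i => le_tsub_add
    _ = ∑' i, (a * ENNReal.ofReal (b i) + ∫⁻ τ in Ioi (b i), distribution μ (k i) τ) := by
        rw [lintegral_tsum fun i => ((hk i).sub_const _).aemeasurable, ENNReal.tsum_add,
          ENNReal.tsum_mul_left]
        simp only [lintegral_tsub_eq (hk _) (hb _)]
        rfl
    _ ≤ _ := ENNReal.tsum_le_tsum hle

/-- Here the optimal level `b` of the sum serves for both summands, because `(k - b)₊ + (e - b)₊ ≤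
(k + e - b)₊`. -/
lemma lintegral_min_add_distribution_le [SFinite μ] {k e : X → ℝ≥0∞} (hk : Measurable k)
    (he : Measurable e) {a : ℝ≥0∞} (ha : a ≠ 0) :
    ∫⁻ τ in Ioi (0 : ℝ), min (distribution μ k τ + distribution μ e τ) a ≤
      ∫⁻ τ in Ioi (0 : ℝ), min (distribution μ (fun x => k x + e x) τ) a := by
  by_cases hfin : ∫⁻ τ in Ioi (0 : ℝ), min (distribution μ (fun x => k x + e x) τ) a = ∞
  · rw [hfin]; exact le_top
  obtain ⟨b, hb, hle⟩ := exists_lintegral_min_eq (distribution_antitone (μ := μ) _) ha hfin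
  refine le_trans ?_ hle
  refine (lintegral_min_le _ a hb).trans ?_
  rw [← lintegral_tsub_eq (k := fun x => k x + e x) (hk.add he) hb, lintegral_add_left (measurable_distribution k),
    ← lintegral_tsub_eq hk hb, ← lintegral_tsub_eq he hb, ← lintegral_add_left (hk.sub_const _)]
  gcongr with x
  rcases le_total (k x) (ENNReal.ofReal b) with h | h
  · rw [tsub_eq_zero_of_le h, zero_add]
    exact tsub_le_tsub_right le_add_self _
  · refine ENNReal.le_sub_of_add_le_right ENNReal.ofReal_ne_top ?_
    rw [add_right_comm, tsub_add_cancel_of_le h]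
    exact add_le_add_right tsub_le_self _

end Distribution

/-! ### Concave powers as mixtures of truncations -/

section Kernel

lemma lintegral_rpow_indicator {θ : ℝ} (hθ : 0 < θ) (x : ℝ≥0∞) :
    ∫⁻ s in Ioi (0 : ℝ), {s : ℝ | ENNReal.ofReal s < x}.indicator
      (fun s => ENNReal.ofReal (s ^ (θ - 1))) s = x ^ θ / ENNReal.ofReal θ := by
  have key : ∀ M : ℝ, 0 ≤ M → ∫⁻ s in Ioo (0 : ℝ) M, ENNReal.ofReal (s ^ (θ - 1)) =
      ENNReal.ofReal M ^ θ / ENNReal.ofReal θ := by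
    intro M hM
    have hi : IntegrableOn (fun s : ℝ => s ^ (θ - 1)) (Ioc 0 M) := by
      rw [← intervalIntegrable_iff_integrableOn_Ioc_of_le hM]
      exact intervalIntegral.intervalIntegrable_rpow' (by linarith)
    rw [← ofReal_integral_eq_lintegral_ofReal (hi.mono_set Ioo_subset_Ioc_self)]
    · rw [← integral_Ioc_eq_integral_Ioo, ← intervalIntegral.integral_of_le hM,
        integral_rpow (Or.inl (by linarith)), sub_add_cancel, Real.zero_rpow hθ.ne', sub_zero,
        ENNReal.ofReal_div_of_pos hθ, ENNReal.ofReal_rpow_of_nonneg hM hθ.le]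
    · filter_upwards [self_mem_ae_restrict measurableSet_Ioo] with s hs
      exact Real.rpow_nonneg hs.1.le _
  have hm : MeasurableSet {τ : ℝ | ENNReal.ofReal τ < x} :=
    measurableSet_lt ENNReal.measurable_ofReal measurable_const
  rw [lintegral_indicator hm, Measure.restrict_restrict hm]
  rcases eq_or_ne x ∞ with rfl | hy
  · have h1 : {τ : ℝ | ENNReal.ofReal τ < ∞} ∩ Ioi 0 = Ioi 0 := by
      ext τ; simp
    rw [h1, ENNReal.top_rpow_of_pos hθ, ENNReal.top_div_of_ne_top ENNReal.ofReal_ne_top, eq_top_iff]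
    refine le_of_forall_lt fun c hc => ?_
    have h2 : Tendsto (fun n : ℕ => ENNReal.ofReal (n : ℝ) ^ θ / ENNReal.ofReal θ) atTop (𝓝 ∞) := by
      have h3 : Tendsto (fun n : ℕ => ENNReal.ofReal ((n : ℝ) ^ θ / θ)) atTop (𝓝 ∞) :=
        ENNReal.tendsto_ofReal_nhds_top.2
          (((tendsto_rpow_atTop hθ).comp tendsto_natCast_atTop_atTop).atTop_div_const hθ)
      refine h3.congr fun n => ?_
      rw [ENNReal.ofReal_div_of_pos hθ, ENNReal.ofReal_rpow_of_nonneg (Nat.cast_nonneg n) hθ.le]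
    obtain ⟨n, hn⟩ := (h2.eventually (lt_mem_nhds hc)).exists
    refine hn.trans_le ?_
    rw [← key n (Nat.cast_nonneg n)]
    exact lintegral_mono_set Ioo_subset_Ioi_self
  · have : {τ : ℝ | ENNReal.ofReal τ < x} ∩ Ioi 0 = Ioo 0 x.toReal := by
      ext τ
      simp only [mem_inter_iff, mem_ofPred_eq, mem_Ioi, mem_Ioo]
      constructor
      · rintro ⟨h1, h2⟩
        exact ⟨h2, (ENNReal.ofReal_lt_iff_lt_toReal h2.le hy).1 h1⟩
      · rintro ⟨h1, h2⟩
        exact ⟨(ENNReal.ofReal_lt_iff_lt_toReal h1.le hy).2 h2, h1⟩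
    rw [this, key _ ENNReal.toReal_nonneg, ENNReal.ofReal_toReal hy]

lemma lintegral_Ioi_rpow {θ : ℝ} (hθ1 : θ < 1) {s : ℝ} (hs : 0 < s) :
    ∫⁻ a in Ioi s, ENNReal.ofReal (a ^ (θ - 2)) =
      ENNReal.ofReal (s ^ (θ - 1)) / ENNReal.ofReal (1 - θ) := by
  rw [← ofReal_integral_eq_lintegral_ofReal
    (integrableOn_Ioi_rpow_of_lt (by linarith : θ - 2 < -1) hs)]
  · rw [integral_Ioi_rpow_of_lt (by linarith) hs, ← ENNReal.ofReal_div_of_pos (by linarith)]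
    congr 1
    rw [show θ - 2 + 1 = -(1 - θ) by ring, div_neg, neg_div, neg_neg, neg_sub]
  · filter_upwards [self_mem_ae_restrict measurableSet_Ioi] with a ha
    exact Real.rpow_nonneg (hs.le.trans (le_of_lt ha)) _

/-- Every power with exponent in `(0, 1)` is a mixture of the functions `x ↦ min x a`. -/
lemma lintegral_min_mul_rpow {θ : ℝ} (hθ : 0 < θ) (hθ1 : θ < 1) (x : ℝ≥0∞) :
    ∫⁻ a in Ioi (0 : ℝ), min x (ENNReal.ofReal a) * ENNReal.ofReal (a ^ (θ - 2)) =
      x ^ θ / ENNReal.ofReal θ / ENNReal.ofReal (1 - θ) := by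
  -- Writing `min x a` as the length of `{s | s < x, s < a}`, Fubini over this region leaves two
  -- power integrals.
  set D : Set (ℝ × ℝ) := {z | ENNReal.ofReal z.2 < x ∧ z.2 < z.1}
  have hD : MeasurableSet D :=
    (measurableSet_lt (ENNReal.measurable_ofReal.comp measurable_snd) measurable_const).inter
      (measurableSet_lt measurable_snd measurable_fst)
  have hpow : Measurable fun a : ℝ => ENNReal.ofReal (a ^ (θ - 2)) :=
    ENNReal.measurable_ofReal.comp (measurable_id.pow_const _)
  calc ∫⁻ a in Ioi (0 : ℝ), min x (ENNReal.ofReal a) * ENNReal.ofReal (a ^ (θ - 2))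
      = ∫⁻ a in Ioi (0 : ℝ), ∫⁻ s in Ioi (0 : ℝ),
          D.indicator (fun z => ENNReal.ofReal (z.1 ^ (θ - 2))) (a, s) := by
        refine setLIntegral_congr_fun measurableSet_Ioi fun a ha => ?_
        rw [← lintegral_indicator_ofReal_lt (min x (ENNReal.ofReal a)),
          ← lintegral_mul_const' _ _ ENNReal.ofReal_ne_top]
        refine lintegral_congr fun s => ?_
        by_cases h : ENNReal.ofReal s < x ∧ s < a
        · rw [indicator_of_mem (show (a, s) ∈ D from h), indicator_of_mem, Pi.one_apply, one_mul]
          exact lt_min h.1 ((ENNReal.ofReal_lt_ofReal_iff ha).2 h.2)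
        · rw [indicator_of_notMem (show (a, s) ∉ D from h), indicator_of_notMem, zero_mul]
          intro h'
          exact h ⟨(lt_min_iff.1 h').1, (ENNReal.ofReal_lt_ofReal_iff ha).1 (lt_min_iff.1 h').2⟩
    _ = ∫⁻ s in Ioi (0 : ℝ), ∫⁻ a in Ioi (0 : ℝ),
          D.indicator (fun z => ENNReal.ofReal (z.1 ^ (θ - 2))) (a, s) :=
        lintegral_lintegral_swap
          (f := fun a s => D.indicator (fun z => ENNReal.ofReal (z.1 ^ (θ - 2))) (a, s))
          (((hpow.comp measurable_fst).indicator hD).aemeasurable)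
    _ = ∫⁻ s in Ioi (0 : ℝ), {s : ℝ | ENNReal.ofReal s < x}.indicator
          (fun s => ENNReal.ofReal (s ^ (θ - 1))) s / ENNReal.ofReal (1 - θ) := by
        refine setLIntegral_congr_fun measurableSet_Ioi fun s hs => ?_
        by_cases h : ENNReal.ofReal s < x
        · rw [indicator_of_mem (show s ∈ {s : ℝ | ENNReal.ofReal s < x} from h),
            ← lintegral_Ioi_rpow hθ1 hs, ← lintegral_indicator measurableSet_Ioi,
            ← lintegral_indicator measurableSet_Ioi]
          refine lintegral_congr fun a => ?_
          by_cases h' : s < a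
          · rw [indicator_of_mem (show a ∈ Ioi (0 : ℝ) from lt_trans hs h'),
              indicator_of_mem (show (a, s) ∈ D from ⟨h, h'⟩), indicator_of_mem (mem_Ioi.2 h')]
          · rw [indicator_of_notMem (show a ∉ Ioi s from h'), indicator_apply_eq_zero]
            intro _
            exact indicator_of_notMem (fun h2 : (a, s) ∈ D => h' h2.2) _
        · rw [indicator_of_notMem (show s ∉ {s : ℝ | ENNReal.ofReal s < x} from h), ENNReal.zero_div]
          simp only [fun a : ℝ => indicator_of_notMem (fun h2 : (a, s) ∈ D => h h2.1)
            (fun z : ℝ × ℝ => ENNReal.ofReal (z.1 ^ (θ - 2))), lintegral_zero]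
    _ = _ := by
        simp only [div_eq_mul_inv]
        rw [lintegral_mul_const' _ _ (by simp [hθ1]), lintegral_rpow_indicator hθ]
        rfl

/-- Integrating the hypothesis over `a` against the positive weight `a^(θ - 2)` turns truncations
into the power `θ`. -/
lemma lintegral_rpow_le_of_forall_lintegral_min_le {θ : ℝ} (hθ : 0 < θ) (hθ1 : θ < 1)
    {ι : Type*} [Countable ι] {F : ℝ → ℝ≥0∞} {G : ι → ℝ → ℝ≥0∞} (hF : Measurable F)
    (hG : ∀ i, Measurable (G i))
    (h : ∀ a : ℝ≥0∞, a ≠ 0 → ∫⁻ τ in Ioi (0 : ℝ), min (F τ) a ≤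
      ∑' i, ∫⁻ τ in Ioi (0 : ℝ), min (G i τ) a) :
    ∫⁻ τ in Ioi (0 : ℝ), F τ ^ θ ≤ ∑' i, ∫⁻ τ in Ioi (0 : ℝ), G i τ ^ θ := by
  set c : ℝ≥0∞ := ENNReal.ofReal θ * ENNReal.ofReal (1 - θ)
  have hθ' : ENNReal.ofReal θ ≠ 0 := by simpa using hθ
  have hθ1' : ENNReal.ofReal (1 - θ) ≠ 0 := by simpa using hθ1
  have hc : c ≠ ∞ := ENNReal.mul_ne_top ENNReal.ofReal_ne_top ENNReal.ofReal_ne_top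
  have hpow : Measurable fun a : ℝ => ENNReal.ofReal (a ^ (θ - 2)) :=
    ENNReal.measurable_ofReal.comp (measurable_id.pow_const _)
  have hrep : ∀ x : ℝ≥0∞, x ^ θ = c * ∫⁻ a in Ioi (0 : ℝ),
      min x (ENNReal.ofReal a) * ENNReal.ofReal (a ^ (θ - 2)) := by
    intro x
    rw [lintegral_min_mul_rpow hθ hθ1, mul_assoc, ENNReal.mul_div_cancel hθ1'
      ENNReal.ofReal_ne_top, ENNReal.mul_div_cancel hθ' ENNReal.ofReal_ne_top]
  have hint : ∀ H : ℝ → ℝ≥0∞, Measurable H → ∫⁻ τ in Ioi (0 : ℝ), H τ ^ θ =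
      c * ∫⁻ a in Ioi (0 : ℝ), (∫⁻ τ in Ioi (0 : ℝ), min (H τ) (ENNReal.ofReal a)) *
        ENNReal.ofReal (a ^ (θ - 2)) := by
    intro H hH
    simp only [hrep]
    rw [lintegral_const_mul' _ _ hc, lintegral_lintegral_swap]
    · congr 1
      refine lintegral_congr fun a => ?_
      rw [lintegral_mul_const' _ _ ENNReal.ofReal_ne_top]
    · exact (((hH.comp measurable_fst).min (ENNReal.measurable_ofReal.comp measurable_snd)).mul
        (hpow.comp measurable_snd)).aemeasurable
  rw [hint F hF]
  simp only [hint _ (hG _)]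
  rw [ENNReal.tsum_mul_left, ← lintegral_tsum]
  · refine mul_le_mul_right (setLIntegral_mono' measurableSet_Ioi fun a ha => ?_) c
    rw [ENNReal.tsum_mul_right]
    exact mul_le_mul_left (h _ (by simpa using ha)) _
  · intro i
    refine (Measurable.mul ?_ hpow).aemeasurable
    have : Measurable (Function.uncurry fun (a : ℝ) (τ : ℝ) => min (G i τ) (ENNReal.ofReal a)) :=
      ((hG i).comp measurable_snd).min (ENNReal.measurable_ofReal.comp measurable_fst)
    exact this.lintegral_prod_right

end Kernel

/-! ### Choquet integrals for a concave distortion -/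

section Choquet

variable {X : Type*} [MeasurableSpace X] {μ : Measure X}

lemma choquet_zero {θ : ℝ} (hθ : 0 < θ) : choquet μ θ (fun _ => 0) = 0 := by
  simp [choquet, distribution, hθ]

lemma choquet_const_mul (θ : ℝ) (k : X → ℝ≥0∞) {c : ℝ} (hc : 0 < c) :
    choquet μ θ (fun x => ENNReal.ofReal c * k x) = ENNReal.ofReal c * choquet μ θ k := by
  have h1 : ∀ τ, distribution μ (fun x => ENNReal.ofReal c * k x) (c * τ) = distribution μ k τ := by
    intro τ
    simp only [distribution, ENNReal.ofReal_mul hc.le]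
    congr 1
    ext x
    exact ENNReal.mul_lt_mul_iff_right (by simpa using hc) ENNReal.ofReal_ne_top
  have h2 := Real.smul_map_volume_mul_left hc.ne'
  have hmul : MeasurableEmbedding (fun τ : ℝ => c * τ) :=
    (Homeomorph.mulLeft₀ c hc.ne').measurableEmbedding
  rw [choquet]
  nth_rewrite 1 [← h2]
  rw [Measure.restrict_smul, lintegral_smul_measure, hmul.restrict_map, hmul.lintegral_map]
  simp only [h1, abs_of_pos hc, smul_eq_mul]
  have : (fun τ => c * τ) ⁻¹' Ioi (0 : ℝ) = Ioi 0 := by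
    ext τ; simp [hc]
  rw [this, choquet]

variable [SFinite μ]

/-- Countable subadditivity of the Choquet integral for the concave distortion `x ↦ x ^ θ`. -/
lemma choquet_tsum_le {θ : ℝ} (hθ : 0 < θ) (hθ1 : θ ≤ 1) {k : ℕ → X → ℝ≥0∞}
    (hk : ∀ i, Measurable (k i)) :
    choquet μ θ (fun x => ∑' i, k i x) ≤ ∑' i, choquet μ θ (k i) := by
  rcases hθ1.eq_or_lt with rfl | hθ1
  · rw [choquet_one (Measurable.tsum hk), lintegral_tsum fun i => (hk i).aemeasurable]
    exact ENNReal.tsum_le_tsum fun i => (choquet_one (hk i)).ge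
  · exact lintegral_rpow_le_of_forall_lintegral_min_le hθ hθ1 (measurable_distribution _)
      (fun i => measurable_distribution _) fun a ha => lintegral_min_distribution_tsum_le hk ha

lemma choquet_add_le {θ : ℝ} (hθ : 0 < θ) (hθ1 : θ ≤ 1) {k e : X → ℝ≥0∞}
    (hk : Measurable k) (he : Measurable e) :
    choquet μ θ (fun x => k x + e x) ≤ choquet μ θ k + choquet μ θ e := by
  let f : ℕ → X → ℝ≥0∞ := fun i => if i = 0 then k else if i = 1 then e else fun _ => 0
  have hf : ∀ i, Measurable (f i) := by
    intro i
    simp only [f]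
    split_ifs
    exacts [hk, he, measurable_const]
  have h := choquet_tsum_le (μ := μ) hθ hθ1 hf
  have h0 : ∀ i, i ∉ Finset.range 2 → f i = fun _ => 0 := by
    intro i hi
    have : 2 ≤ i := by rw [Finset.mem_range] at hi; omega
    simp [f, show i ≠ 0 by omega, show i ≠ 1 by omega]
  rw [tsum_eq_sum (s := Finset.range 2) fun i hi => by rw [h0 i hi]; exact choquet_zero hθ] at h
  have h2 : (fun x => ∑' i, f i x) = fun x => k x + e x := by
    ext x
    rw [tsum_eq_sum (s := Finset.range 2) fun i hi => by rw [h0 i hi]]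
    simp [Finset.sum_range_succ, f]
  rw [h2] at h
  simpa [Finset.sum_range_succ, f] using h

lemma lintegral_add_distribution_rpow_le {θ : ℝ} (hθ : 0 < θ) (hθ1 : θ ≤ 1) {k e : X → ℝ≥0∞}
    (hk : Measurable k) (he : Measurable e) :
    ∫⁻ τ in Ioi (0 : ℝ), (distribution μ k τ + distribution μ e τ) ^ θ ≤
      choquet μ θ (fun x => k x + e x) := by
  rcases hθ1.eq_or_lt with rfl | hθ1
  · rw [choquet_one (k := fun x => k x + e x) (hk.add he), lintegral_add_left hk]
    simp only [ENNReal.rpow_one]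
    rw [lintegral_add_left (measurable_distribution k), ← lintegral_eq_lintegral_distribution hk,
      ← lintegral_eq_lintegral_distribution he]
  · have := lintegral_rpow_le_of_forall_lintegral_min_le (ι := Unit) hθ hθ1
      ((measurable_distribution (μ := μ) k).add (measurable_distribution e))
      (G := fun _ => distribution μ (fun x => k x + e x))
      (fun i => measurable_distribution _) fun a ha => by
        simpa using lintegral_min_add_distribution_le hk he ha
    simpa [choquet] using this

/-- Concavity of the power `θ` at the points `x` and `y / m` with weights `1 - m` and `m`. The use
lies in small `m`: giving up the fraction `m` of the main term buys the much larger multiple `m^(1 -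
θ)` of the second one. -/
lemma rpow_add_ge {θ : ℝ} (hθ : 0 < θ) (hθ1 : θ ≤ 1) {m : ℝ≥0} (hm : 0 < m) (hm1 : m < 1)
    (x y : ℝ≥0∞) :
    ((1 - m : ℝ≥0) : ℝ≥0∞) * x ^ θ + (m : ℝ≥0∞) ^ (1 - θ) * y ^ θ ≤ (x + y) ^ θ := by
  have hm0 : (m : ℝ≥0∞) ≠ 0 := by simpa using hm.ne'
  have hmt : (m : ℝ≥0∞) ≠ ∞ := ENNReal.coe_ne_top
  have hw : ((1 - m : ℝ≥0) : ℝ≥0∞) + (m : ℝ≥0∞) = 1 := by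
    rw [← ENNReal.coe_add, tsub_add_cancel_of_le hm1.le, ENNReal.coe_one]
  have h := ENNReal.rpow_arith_mean_le_arith_mean2_rpow ((1 - m : ℝ≥0) : ℝ≥0∞) m (x ^ θ)
    ((y / m) ^ θ) hw (p := θ⁻¹) (one_le_inv_iff₀.2 ⟨hθ, hθ1⟩)
  rw [ENNReal.rpow_rpow_inv hθ.ne', ENNReal.rpow_rpow_inv hθ.ne',
    ENNReal.mul_div_cancel hm0 hmt] at h
  have h1 : (m : ℝ≥0∞) ^ (1 - θ) * y ^ θ = m * (y / m) ^ θ := by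
    rw [ENNReal.div_rpow_of_nonneg _ _ hθ.le, ENNReal.rpow_sub _ _ hm0 hmt, ENNReal.rpow_one]
    simp only [div_eq_mul_inv]; ring
  rw [h1]
  calc _ = ((((1 - m : ℝ≥0) : ℝ≥0∞) * x ^ θ + m * (y / m) ^ θ) ^ θ⁻¹) ^ θ := by
        rw [ENNReal.rpow_inv_rpow hθ.ne']
    _ ≤ _ := by
        refine ENNReal.rpow_le_rpow (h.trans (add_le_add_left ?_ _)) hθ.le
        exact mul_le_of_le_one_left' (by simp)

/-- A lower estimate for the Choquet integral of a sum. -/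
lemma choquet_add_ge {θ : ℝ} (hθ : 0 < θ) (hθ1 : θ ≤ 1) {k e : X → ℝ≥0∞}
    (hk : Measurable k) (he : Measurable e) {m : ℝ≥0} (hm : 0 < m) (hm1 : m < 1) :
    ((1 - m : ℝ≥0) : ℝ≥0∞) * choquet μ θ k + (m : ℝ≥0∞) ^ (1 - θ) * choquet μ θ e ≤
      choquet μ θ (fun x => k x + e x) := by
  refine le_trans ?_ (lintegral_add_distribution_rpow_le hθ hθ1 hk he)
  have h1 : (m : ℝ≥0∞) ^ (1 - θ) ≠ ∞ :=
    ENNReal.rpow_ne_top_of_nonneg (by linarith) ENNReal.coe_ne_top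
  rw [choquet, choquet, ← lintegral_const_mul' _ _ ENNReal.coe_ne_top,
    ← lintegral_const_mul' _ _ h1, ← lintegral_add_left
      (((measurable_distribution k).pow_const _).const_mul _)]
  exact lintegral_mono fun τ => rpow_add_ge hθ hθ1 hm hm1 _ _

end Choquet

/-! ### Lorentz norms through distribution functions -/

section Lorentz

variable {X : Type*} [MeasurableSpace X] {μ : Measure X}

lemma lt_rearrangement_iff (f : X → ℝ≥0∞) (t : ℝ) (v : ℝ≥0∞) :
    v < rearrangement μ f t ↔ ENNReal.ofReal t < μ {x | v < f x} := by
  constructor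
  · intro h
    by_contra h'
    exact absurd (sInf_le (show v ∈ {v : ℝ≥0∞ | μ {x | v < f x} ≤ ENNReal.ofReal t} from
      not_lt.1 h')) (not_le.2 h)
  · intro h
    have hv : v < ∞ := by
      rw [lt_top_iff_ne_top]
      rintro rfl
      simp at h
    -- Continuity of the measure from below: some level strictly above `v` still has a superlevel
    -- set of measure larger than `t`, which makes the inequality for the infimum strict.
    obtain ⟨w, hw, hwv, hlim⟩ := exists_seq_strictAnti_tendsto' hv
    have hU : {x | v < f x} = ⋃ n, {x | w n < f x} := by
      ext x
      simp only [mem_ofPred_eq, mem_iUnion]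
      constructor
      · intro hx
        exact (hlim.eventually (gt_mem_nhds hx)).exists
      · rintro ⟨n, hn⟩
        exact (hwv n).1.trans hn
    have hmono : Monotone fun n => {x | w n < f x} := fun m n hmn x hx =>
      lt_of_le_of_lt (hw.antitone hmn) hx
    rw [hU, hmono.measure_iUnion, lt_iSup_iff] at h
    obtain ⟨n, hn⟩ := h
    refine (hwv n).1.trans_le (le_sInf fun u hu => ?_)
    by_contra hun
    exact absurd (hn.trans_le ((measure_mono fun x hx => (not_le.1 hun).trans hx).trans hu))
      (lt_irrefl _)

/-- The Lorentz norm with finite second exponent in terms of the distribution function. -/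
lemma lorentzNorm_rpow_toReal {p : ℝ} (hp : 0 < p) {q : ℝ≥0∞} (hq0 : q ≠ 0) (hq : q ≠ ∞)
    (f : X → ℝ≥0∞) :
    lorentzNorm p q μ f ^ q.toReal =
      choquet μ (q.toReal / p) (fun x => f x ^ q.toReal) / ENNReal.ofReal (q.toReal / p) := by
  have hs : 0 < q.toReal := ENNReal.toReal_pos hq0 hq
  set s := q.toReal
  rw [lorentzNorm, if_neg hq, one_div q.toReal, ENNReal.rpow_inv_rpow hs.ne']
  set N := distribution μ (fun x => f x ^ s)
  have hN : Measurable N := measurable_distribution _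
  -- The superlevel sets of the rearrangement and of `f` determine the same region in the `(t, τ)`
  -- plane; integrating in `t` first produces the power `s / p` of the distribution function.
  set D : Set (ℝ × ℝ) := {z | ENNReal.ofReal z.1 < N z.2}
  have hD : MeasurableSet D :=
    measurableSet_lt (ENNReal.measurable_ofReal.comp measurable_fst) (hN.comp measurable_snd)
  have hpow : Measurable fun t : ℝ => ENNReal.ofReal (t ^ (s / p - 1)) :=
    ENNReal.measurable_ofReal.comp (measurable_id.pow_const _)
  calc _ = ∫⁻ t in Ioi (0 : ℝ), ∫⁻ τ in Ioi (0 : ℝ),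
          D.indicator (fun z => ENNReal.ofReal (z.1 ^ (s / p - 1))) (t, τ) := by
        refine setLIntegral_congr_fun measurableSet_Ioi fun t ht => ?_
        have ht' : ENNReal.ofReal t ≠ 0 := by simpa using ht
        have h1 : (ENNReal.ofReal t ^ (1 / p) * rearrangement μ f t) ^ s / ENNReal.ofReal t =
            rearrangement μ f t ^ s * ENNReal.ofReal (t ^ (s / p - 1)) := by
          rw [ENNReal.mul_rpow_of_nonneg _ _ hs.le, ← ENNReal.rpow_mul,
            ← ENNReal.ofReal_rpow_of_pos ht, ENNReal.rpow_sub _ _ ht' ENNReal.ofReal_ne_top,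
            ENNReal.rpow_one, one_div_mul_eq_div]
          simp only [div_eq_mul_inv]; ring
        rw [h1, ← lintegral_indicator_ofReal_lt (rearrangement μ f t ^ s),
          ← lintegral_mul_const' _ _ ENNReal.ofReal_ne_top]
        refine lintegral_congr fun τ => ?_
        have h2 : τ ∈ {τ : ℝ | ENNReal.ofReal τ < rearrangement μ f t ^ s} ↔ (t, τ) ∈ D := by
          rw [mem_ofPred_eq, ← ENNReal.rpow_inv_rpow hs.ne' (ENNReal.ofReal τ), ENNReal.rpow_lt_rpow_iff hs,
            lt_rearrangement_iff]
          simp only [D, N, distribution, mem_ofPred_eq]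
          have : ∀ x, (ENNReal.ofReal τ) ^ s⁻¹ < f x ↔ ENNReal.ofReal τ < f x ^ s := fun x => by
            conv_rhs => rw [← ENNReal.rpow_inv_rpow hs.ne' (ENNReal.ofReal τ)]
            rw [ENNReal.rpow_lt_rpow_iff hs]
          simp only [this]
        by_cases h : (t, τ) ∈ D
        · rw [indicator_of_mem h, indicator_of_mem (h2.2 h), Pi.one_apply, one_mul]
        · rw [indicator_of_notMem h, indicator_of_notMem (fun h' => h (h2.1 h')), zero_mul]
    _ = ∫⁻ τ in Ioi (0 : ℝ), ∫⁻ t in Ioi (0 : ℝ),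
          D.indicator (fun z => ENNReal.ofReal (z.1 ^ (s / p - 1))) (t, τ) :=
        lintegral_lintegral_swap
          (f := fun t τ => D.indicator (fun z => ENNReal.ofReal (z.1 ^ (s / p - 1))) (t, τ))
          (((hpow.comp measurable_fst).indicator hD).aemeasurable)
    _ = ∫⁻ τ in Ioi (0 : ℝ), N τ ^ (s / p) / ENNReal.ofReal (s / p) := by
        refine lintegral_congr fun τ => ?_
        rw [← lintegral_rpow_indicator (div_pos hs hp)]
        rfl
    _ = _ := by
        simp only [ENNReal.div_eq_inv_mul]
        rw [lintegral_const_mul' _ _ (ENNReal.inv_ne_top.2 (by simpa using div_pos hs hp))]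
        rfl

lemma lorentzNorm_top_rpow {p : ℝ} (hp : 0 < p) (f : X → ℝ≥0∞) :
    lorentzNorm p ∞ μ f ^ p = ⨆ (t : ℝ≥0) (_ : 0 < t), (t : ℝ≥0∞) ^ p * μ {x | (t : ℝ≥0∞) < f x} := by
  rw [lorentzNorm, if_pos rfl]
  apply le_antisymm
  · rw [← ENNReal.le_rpow_inv_iff hp]
    refine iSup₂_le fun t ht => ?_
    rw [ENNReal.le_rpow_inv_iff hp, ENNReal.mul_rpow_of_nonneg _ _ hp.le, one_div,
      ENNReal.rpow_inv_rpow hp.ne']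
    exact le_iSup₂_of_le t ht le_rfl
  · refine iSup₂_le fun t ht => ?_
    rw [← ENNReal.rpow_inv_rpow hp.ne' (μ _), ← ENNReal.mul_rpow_of_nonneg _ _ hp.le, ← one_div]
    exact ENNReal.rpow_le_rpow (le_iSup₂_of_le t ht le_rfl) hp.le

lemma lorentzNorm_eq_zero_of_ae_eq_zero {p : ℝ} (hp : 0 < p) {q : ℝ≥0∞} (hq0 : q ≠ 0)
    {f : X → ℝ≥0∞} (hf : μ {x | f x ≠ 0} = 0) : lorentzNorm p q μ f = 0 := by
  have h : ∀ v : ℝ≥0∞, μ {x | v < f x} = 0 := fun v =>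
    measure_mono_null (fun x hx => (lt_of_le_of_lt zero_le hx).ne') hf
  by_cases hq : q = ∞
  · simp [lorentzNorm, hq, h, hp]
  · have hs : 0 < q.toReal := ENNReal.toReal_pos hq0 hq
    simp [lorentzNorm, hq, h, rearrangement, hs]

lemma measure_eq_top_eq_zero_of_lorentzNorm_lt_top {p : ℝ} (hp : 0 < p) {q : ℝ≥0∞} (hq0 : q ≠ 0)
    {f : X → ℝ≥0∞} (hf : lorentzNorm p q μ f < ∞) : μ {x | f x = ∞} = 0 := by
  by_contra hz
  rw [lt_top_iff_ne_top] at hf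
  apply hf
  by_cases hq : q = ∞
  · subst hq
    rw [← ENNReal.rpow_eq_top_iff_of_pos hp, lorentzNorm_top_rpow hp, eq_top_iff]
    have h1 : Tendsto (fun n : ℕ => (n : ℝ≥0∞) ^ p * μ {x | f x = ∞}) atTop (𝓝 (∞ * μ {x | f x = ∞})) := by
      refine ENNReal.Tendsto.mul_const ?_ (Or.inl ENNReal.top_ne_zero)
      have := (ENNReal.continuous_rpow_const (y := p)).tendsto ∞
      rw [ENNReal.top_rpow_of_pos hp] at this
      exact this.comp ENNReal.tendsto_nat_nhds_top
    rw [ENNReal.top_mul hz] at h1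
    refine le_of_tendsto h1 ?_
    filter_upwards [eventually_gt_atTop 0] with n hn
    refine le_iSup₂_of_le (n : ℝ≥0) (by exact_mod_cast hn) ?_
    rw [ENNReal.coe_natCast]
    gcongr with x
    intro hx
    rw [hx]
    exact ENNReal.natCast_lt_top n
  · have hs : 0 < q.toReal := ENNReal.toReal_pos hq0 hq
    rw [← ENNReal.rpow_eq_top_iff_of_pos hs, lorentzNorm_rpow_toReal hp hq0 hq]
    refine ENNReal.div_eq_top.2 (Or.inr ⟨?_, ENNReal.ofReal_ne_top⟩)
    rw [eq_top_iff, choquet]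
    calc ∞ = ∫⁻ τ in Ioi (0 : ℝ), μ {x | f x = ∞} ^ (q.toReal / p) := by
          simp [hz, div_pos hs hp, (div_pos hs hp).not_gt]
      _ ≤ _ := by
          refine lintegral_mono fun τ => ENNReal.rpow_le_rpow (measure_mono fun x hx => ?_)
            (div_pos hs hp).le
          rw [mem_ofPred_eq] at hx
          simp [hx, ENNReal.top_rpow_of_pos hs]

/-- The exponent in the definition of the Newtonian norm. -/
noncomputable def newtonianExponent (p : ℝ) (q : ℝ≥0∞) : ℝ :=
  if q ≤ ENNReal.ofReal p then q.toReal else p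

lemma newtonianExponent_pos {p : ℝ} (hp : 0 < p) {q : ℝ≥0∞} (hq0 : q ≠ 0) :
    0 < newtonianExponent p q := by
  rw [newtonianExponent]
  split_ifs with h
  · exact ENNReal.toReal_pos hq0 (h.trans_lt ENNReal.ofReal_lt_top).ne
  · exact hp

/-- Minkowski's inequality for countable sums: finite sums by induction, then monotone convergence.
-/
lemma lintegral_tsum_rpow_le {α : Type*} [MeasurableSpace α] {ν : Measure α} {θ : ℝ} (hθ : 1 ≤ θ)
    {F : ℕ → α → ℝ≥0∞} (hF : ∀ i, Measurable (F i)) :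
    (∫⁻ a, (∑' i, F i a) ^ θ ∂ν) ^ (1 / θ) ≤ ∑' i, (∫⁻ a, F i a ^ θ ∂ν) ^ (1 / θ) := by
  have h0 : 0 < θ := by linarith
  have hfin : ∀ n, (∫⁻ a, (∑ i ∈ Finset.range n, F i a) ^ θ ∂ν) ^ (1 / θ) ≤
      ∑ i ∈ Finset.range n, (∫⁻ a, F i a ^ θ ∂ν) ^ (1 / θ) := by
    intro n
    induction n with
    | zero => simp [h0]
    | succ n ih =>
      simp only [Finset.sum_range_succ]
      refine le_trans ?_ (add_le_add_left ih _)
      exact ENNReal.lintegral_Lp_add_le (f := fun a => ∑ i ∈ Finset.range n, F i a)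
        (Finset.measurable_fun_sum _ fun i _ => hF i).aemeasurable (hF n).aemeasurable hθ
  have hmono : ∀ a, Monotone fun n => (∑ i ∈ Finset.range n, F i a) ^ θ := fun a m n hmn =>
    ENNReal.rpow_le_rpow (Finset.sum_le_sum_of_subset (Finset.range_mono hmn)) h0.le
  rw [one_div, ENNReal.rpow_inv_le_iff h0]
  have h1 : ∀ a, (∑' i, F i a) ^ θ = ⨆ n, (∑ i ∈ Finset.range n, F i a) ^ θ := fun a =>
    tendsto_nhds_unique
      (((ENNReal.continuous_rpow_const (y := θ)).tendsto _).comp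
        (ENNReal.summable.hasSum.tendsto_sum_nat)) (tendsto_atTop_iSup (hmono a))
  simp only [h1]
  rw [lintegral_iSup (fun n => (Finset.measurable_fun_sum _ fun i _ => hF i).pow_const _)
    fun m n hmn a => hmono a hmn]
  refine iSup_le fun n => ?_
  rw [← ENNReal.rpow_inv_le_iff h0, ← one_div]
  exact (hfin n).trans (ENNReal.sum_le_tsum _)

lemma iSup_rpow_le_tsum {s : ℝ} (hs : 0 < s) (a : ℕ → ℝ≥0∞) : (⨆ i, a i) ^ s ≤ ∑' i, a i ^ s := by
  rw [← ENNReal.le_rpow_inv_iff hs]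
  refine iSup_le fun i => ?_
  rw [ENNReal.le_rpow_inv_iff hs]
  exact ENNReal.le_tsum i

lemma measure_lt_iSup_le (f : ℕ → X → ℝ≥0∞) (v : ℝ≥0∞) :
    μ {x | v < ⨆ i, f i x} ≤ ∑' i, μ {x | v < f i x} := by
  refine le_trans (measure_mono fun x hx => ?_) (measure_iUnion_le _)
  rw [mem_ofPred_eq, lt_iSup_iff] at hx
  exact mem_iUnion.2 hx

/-- The Newtonian exponent is the one that makes this subadditivity hold on both sides of `q = p`.
For `q ≤ p` the supremum of the `s`-th powers is bounded by their sum inside the Choquet integral;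
for `q > p` the distribution function of the supremum is bounded by the sum of the distribution
functions. -/
lemma lorentzNorm_iSup_rpow_le [SFinite μ] {p : ℝ} (hp : 0 < p) {q : ℝ≥0∞} (hq0 : q ≠ 0)
    {f : ℕ → X → ℝ≥0∞} (hf : ∀ i, Measurable (f i)) :
    lorentzNorm p q μ (fun x => ⨆ i, f i x) ^ newtonianExponent p q ≤
      ∑' i, lorentzNorm p q μ (f i) ^ newtonianExponent p q := by
  rw [newtonianExponent]
  split_ifs with hqp
  · have hq : q ≠ ∞ := (hqp.trans_lt ENNReal.ofReal_lt_top).ne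
    have hs : 0 < q.toReal := ENNReal.toReal_pos hq0 hq
    have hle : q.toReal / p ≤ 1 := by
      rw [div_le_one hp]
      exact ENNReal.toReal_le_of_le_ofReal hp.le hqp
    simp only [lorentzNorm_rpow_toReal hp hq0 hq, div_eq_mul_inv, ENNReal.tsum_mul_right]
    refine mul_le_mul_left ?_ _
    refine le_trans ?_ (choquet_tsum_le (div_pos hs hp) hle fun i => (hf i).pow_const _)
    exact choquet_mono (div_pos hs hp).le fun x => iSup_rpow_le_tsum hs _
  · by_cases hq : q = ∞
    · subst hq
      simp only [lorentzNorm_top_rpow hp]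
      refine iSup₂_le fun t ht => ?_
      calc _ ≤ (t : ℝ≥0∞) ^ p * ∑' i, μ {x | (t : ℝ≥0∞) < f i x} := by
            gcongr; exact measure_lt_iSup_le f t
        _ = ∑' i, (t : ℝ≥0∞) ^ p * μ {x | (t : ℝ≥0∞) < f i x} := ENNReal.tsum_mul_left.symm
        _ ≤ _ := ENNReal.tsum_le_tsum fun i => le_iSup₂_of_le t ht le_rfl
    · have hs : 0 < q.toReal := ENNReal.toReal_pos hq0 hq
      have hps : p ≤ q.toReal := by
        have := (not_le.1 hqp).le
        exact (ENNReal.ofReal_le_iff_le_toReal hq).1 this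
      -- Up to a constant, `‖g‖^p` is the `L^{q/p}(dτ)` norm of the distribution function of `g^q`,
      -- so Minkowski applies.
      have h1 : ∀ g : X → ℝ≥0∞, lorentzNorm p q μ g ^ p =
          choquet μ (q.toReal / p) (fun x => g x ^ q.toReal) ^ (1 / (q.toReal / p)) *
            (ENNReal.ofReal (q.toReal / p))⁻¹ ^ (1 / (q.toReal / p)) := by
        intro g
        rw [← ENNReal.mul_rpow_of_nonneg _ _ (by positivity), ← div_eq_mul_inv,
          ← lorentzNorm_rpow_toReal hp hq0 hq, ← ENNReal.rpow_mul]
        congr 1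
        field_simp
      simp only [h1, ENNReal.tsum_mul_right]
      refine mul_le_mul_left ?_ _
      refine le_trans ?_ (lintegral_tsum_rpow_le ((one_le_div hp).2 hps)
        fun i => measurable_distribution _)
      refine ENNReal.rpow_le_rpow (lintegral_mono fun τ => ENNReal.rpow_le_rpow ?_
        (div_pos hs hp).le) (by positivity)
      refine le_trans (measure_mono fun x hx => ?_) (measure_iUnion_le _)
      rw [mem_ofPred_eq] at hx
      simp only [mem_iUnion]
      by_contra! h
      refine absurd hx (not_lt.2 ?_)
      rw [← ENNReal.le_rpow_inv_iff hs]
      refine iSup_le fun i => ?_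
      rw [ENNReal.le_rpow_inv_iff hs]
      exact not_lt.1 (h i)

end Lorentz

/-! ### Subcurves and the upper gradient inequality -/

section Curves

variable {X : Type*} [MetricSpace X]

/-- The restriction of a curve to `[a, b] ⊆ [0, ℓ]`. -/
def RectifiableCurve.restrict (γ : RectifiableCurve X) {a b : ℝ} (ha : 0 ≤ a) (hab : a < b)
    (hb : b ≤ γ.length) : RectifiableCurve X where
  toFun := fun s => γ.toFun (a + s)
  length := b - a
  length_pos := sub_pos.2 hab
  unitSpeed := by
    intro x hx y hy
    have h := γ.unitSpeed (x := a + x) ⟨by linarith [hx.1], by linarith [hx.2]⟩ (y := a + y)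
      ⟨by linarith [hy.1], by linarith [hy.2]⟩
    have h1 : Icc 0 (b - a) ∩ Icc x y = Icc x y :=
      inter_eq_right.2 (Icc_subset_Icc hx.1 hy.2)
    have h2 : Icc 0 γ.length ∩ Icc (a + x) (a + y) = Icc (a + x) (a + y) :=
      inter_eq_right.2 (Icc_subset_Icc (by linarith [hx.1]) (by linarith [hy.2]))
    have h3 : (fun s => γ.toFun (a + s)) = γ.toFun ∘ (a + ·) := rfl
    rw [h2] at h
    rw [h1, h3, eVariationOn.comp_eq_of_monotoneOn _ _ (fun _ _ _ _ hst => add_le_add_right hst a),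
      image_const_add_Icc, h]
    simp

lemma RectifiableCurve.curveIntegral_restrict_le (γ : RectifiableCurve X) {a b : ℝ} (ha : 0 ≤ a)
    (hab : a < b) (hb : b ≤ γ.length) (ρ : X → ℝ≥0∞) :
    curveIntegral (γ.restrict ha hab hb) ρ ≤ curveIntegral γ ρ := by
  have h := (measurePreserving_add_left (volume : Measure ℝ) a).setLIntegral_comp_preimage_emb
    (measurableEmbedding_addLeft a) (fun s => ρ (γ.toFun s)) (Icc a b)
  have h1 : (fun s => a + s) ⁻¹' Icc a b = Icc 0 (b - a) := by
    simp
  rw [h1] at h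
  calc _ = ∫⁻ s in Icc a b, ρ (γ.toFun s) := h
    _ ≤ _ := lintegral_mono_set (Icc_subset_Icc ha hb)

lemma curveIntegral_mono (γ : RectifiableCurve X) {ρ σ : X → ℝ≥0∞} (h : ∀ x, ρ x ≤ σ x) :
    curveIntegral γ ρ ≤ curveIntegral γ σ :=
  lintegral_mono fun _ => h _

/-- The upper gradient inequality on `γ` for a `[0, ∞]`-valued function. -/
def GradientBoundOn (v g : X → ℝ≥0∞) (γ : RectifiableCurve X) : Prop :=
  v (γ.toFun 0) ≤ v (γ.toFun γ.length) + curveIntegral γ g ∧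
  v (γ.toFun γ.length) ≤ v (γ.toFun 0) + curveIntegral γ g ∧
  (v (γ.toFun 0) = ∞ ∨ v (γ.toFun γ.length) = ∞ → curveIntegral γ g = ∞)

lemma abs_coe_sub_coe_le_iff (a b : ℝ) (I : ℝ≥0∞) :
    ((a : EReal) - (b : EReal)).abs ≤ I ↔ ENNReal.ofReal |a - b| ≤ I := by
  rw [← EReal.coe_sub, EReal.abs_def]

lemma abs_coe_ennreal (v : ℝ≥0∞) : (v : EReal).abs = v := by
  induction v with
  | top => simp
  | coe r =>
    rw [show (((r : ℝ≥0) : ℝ≥0∞) : EReal) = ((r : ℝ) : EReal) from rfl, EReal.abs_def,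
      abs_of_nonneg r.coe_nonneg, ENNReal.ofReal_coe_nnreal]

/-- By the reverse triangle inequality, passing from `u` to its absolute value keeps the gradient.
With the converse below, the capacity can be computed with `[0, ∞]`-valued functions only. -/
lemma UpperGradientOn.gradientBoundOn {u : X → EReal} {g : X → ℝ≥0∞} {γ : RectifiableCurve X}
    (h : UpperGradientOn u g γ) : GradientBoundOn (absFun u) g γ := by
  unfold UpperGradientOn at h
  split_ifs at h with hf
  · obtain ⟨h0, h1⟩ := hf
    refine ⟨?_, ?_, fun h' => ?_⟩
    rotate_left 2
    · rcases h' with h' | h'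
      · exact absurd h' h0.ne
      · exact absurd h' h1.ne
    all_goals
      simp only [absFun]
      generalize u (γ.toFun 0) = x at *
      generalize u (γ.toFun γ.length) = y at *
      induction x with
      | bot => simp at h0
      | top => simp at h0
      | coe a =>
      induction y with
      | bot => simp at h1
      | top => simp at h1
      | coe b =>
      rw [abs_coe_sub_coe_le_iff] at h
      rw [EReal.abs_def, EReal.abs_def]
      refine le_trans ?_ (add_le_add_right h _)
      rw [← ENNReal.ofReal_add (abs_nonneg _) (abs_nonneg _)]
      apply ENNReal.ofReal_le_ofReal
      have e1 := abs_sub_abs_le_abs_sub a b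
      have e2 := abs_sub_abs_le_abs_sub b a
      rw [abs_sub_comm b a] at e2
      linarith
  · exact ⟨by simp [h], by simp [h], fun _ => h⟩

lemma GradientBoundOn.upperGradientOn {v g : X → ℝ≥0∞} {γ : RectifiableCurve X}
    (h : GradientBoundOn v g γ) : UpperGradientOn (fun x => (v x : EReal)) g γ := by
  obtain ⟨h1, h2, h3⟩ := h
  unfold UpperGradientOn
  simp only [abs_coe_ennreal]
  split_ifs with hf
  · obtain ⟨f0, f1⟩ := hf
    generalize v (γ.toFun 0) = x at *
    generalize v (γ.toFun γ.length) = y at *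
    lift x to ℝ≥0 using f0.ne
    lift y to ℝ≥0 using f1.ne
    rw [show (((x : ℝ≥0) : ℝ≥0∞) : EReal) = ((x : ℝ) : EReal) from rfl,
      show (((y : ℝ≥0) : ℝ≥0∞) : EReal) = ((y : ℝ) : EReal) from rfl, abs_coe_sub_coe_le_iff]
    rcases le_total (x : ℝ) y with hxy | hxy
    · rw [abs_of_nonpos (by linarith), neg_sub, ENNReal.ofReal_sub _ x.coe_nonneg]
      simpa [add_comm] using h2
    · rw [abs_of_nonneg (by linarith), ENNReal.ofReal_sub _ y.coe_nonneg]
      simpa [add_comm] using h1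
  · apply h3
    rw [not_and_or, not_lt_top_iff, not_lt_top_iff] at hf
    exact hf

end Curves

/-! ### Families of modulus zero and stability of weak upper gradients -/

section Modulus

variable {X : Type*} [MetricSpace X] [MeasurableSpace X] {μ : Measure X} {p : ℝ} {q : ℝ≥0∞}

/-- Vanishing of the modulus does not depend on the power of the norm, so the power for which the
norm of a supremum is countably subadditive may be used. -/
lemma pqModulus_eq_zero_iff (hp : 0 < p) {r : ℝ} (hr : 0 < r) (Γ : Set (RectifiableCurve X)) :
    pqModulus p q μ Γ = 0 ↔ ∀ ε : ℝ≥0∞, 0 < ε → ∃ ρ : X → ℝ≥0∞, Measurable ρ ∧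
      (∀ γ ∈ Γ, 1 ≤ curveIntegral γ ρ) ∧ lorentzNorm p q μ ρ ^ r < ε := by
  constructor
  · intro h ε hε
    have h1 : pqModulus p q μ Γ < ε ^ (p / r) := by
      rw [h]
      exact ENNReal.rpow_pos_of_nonneg hε (div_pos hp hr).le
    simp only [pqModulus, iInf_lt_iff] at h1
    obtain ⟨ρ, hm, hadm, hlt⟩ := h1
    refine ⟨ρ, hm, hadm, ?_⟩
    have h2 := ENNReal.rpow_lt_rpow hlt (div_pos hr hp)
    rwa [← ENNReal.rpow_mul, ← ENNReal.rpow_mul, mul_div_cancel₀ _ hp.ne',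
      div_mul_div_cancel₀ hr.ne', div_self hp.ne', ENNReal.rpow_one] at h2
  · intro h
    refine le_antisymm (le_of_forall_gt fun ε hε => ?_) zero_le
    obtain ⟨ρ, hm, hadm, hlt⟩ := h (ε ^ (r / p)) (ENNReal.rpow_pos_of_nonneg hε (div_pos hr hp).le)
    have h2 := ENNReal.rpow_lt_rpow hlt (div_pos hp hr)
    rw [← ENNReal.rpow_mul, ← ENNReal.rpow_mul, mul_div_cancel₀ _ hr.ne',
      div_mul_div_cancel₀ hp.ne', div_self hr.ne', ENNReal.rpow_one] at h2
    exact lt_of_le_of_lt (iInf_le_of_le ρ (iInf_le_of_le hm (iInf_le _ hadm))) h2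

lemma pqModulus_eq_zero_of_forall_exists_le {Γ Γ' : Set (RectifiableCurve X)}
    (h : pqModulus p q μ Γ = 0)
    (hΓ : ∀ γ ∈ Γ', ∃ γ' ∈ Γ, ∀ ρ, curveIntegral γ' ρ ≤ curveIntegral γ ρ) :
    pqModulus p q μ Γ' = 0 := by
  refine le_antisymm (h ▸ ?_) zero_le
  refine le_iInf fun ρ => le_iInf fun hm => le_iInf fun hadm => ?_
  refine iInf_le_of_le ρ (iInf_le_of_le hm (iInf_le _ fun γ hγ => ?_))
  obtain ⟨γ', h1, h2⟩ := hΓ γ hγ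
  exact (hadm γ' h1).trans (h2 ρ)

lemma pqModulus_mono_null {Γ Γ' : Set (RectifiableCurve X)} (hsub : Γ' ⊆ Γ)
    (h : pqModulus p q μ Γ = 0) : pqModulus p q μ Γ' = 0 :=
  pqModulus_eq_zero_of_forall_exists_le h fun γ hγ => ⟨γ, hsub hγ, fun _ => le_rfl⟩

lemma pqModulus_iUnion_null [SFinite μ] (hp : 0 < p) (hq : q ≠ 0)
    {Γ : ℕ → Set (RectifiableCurve X)} (h : ∀ i, pqModulus p q μ (Γ i) = 0) :
    pqModulus p q μ (⋃ i, Γ i) = 0 := by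
  have hr := newtonianExponent_pos hp hq
  rw [pqModulus_eq_zero_iff hp hr]
  intro ε hε
  obtain ⟨δ, hδ, hsum⟩ := ENNReal.exists_pos_sum_of_countable' hε.ne' ℕ
  choose ρ hm hadm hlt using fun i => (pqModulus_eq_zero_iff hp hr (Γ i)).1 (h i) (δ i) (hδ i)
  refine ⟨fun x => ⨆ i, ρ i x, Measurable.iSup hm, fun γ hγ => ?_, ?_⟩
  · obtain ⟨i, hi⟩ := mem_iUnion.1 hγ
    exact (hadm i γ hi).trans (curveIntegral_mono γ fun x => le_iSup (fun i => ρ i x) i)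
  · exact ((lorentzNorm_iSup_rpow_le hp hq hm).trans
      (ENNReal.tsum_le_tsum fun i => (hlt i).le)).trans_lt hsum

lemma pqModulus_union_null [SFinite μ] (hp : 0 < p) (hq : q ≠ 0)
    {Γ Γ' : Set (RectifiableCurve X)} (h : pqModulus p q μ Γ = 0) (h' : pqModulus p q μ Γ' = 0) :
    pqModulus p q μ (Γ ∪ Γ') = 0 := by
  refine pqModulus_mono_null ?_ (pqModulus_iUnion_null (Γ := fun i => if i = 0 then Γ else Γ')
    hp hq fun i => by split_ifs <;> assumption)
  rintro γ (hγ | hγ)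
  · exact mem_iUnion.2 ⟨0, by simpa using hγ⟩
  · exact mem_iUnion.2 ⟨1, by simpa using hγ⟩

/-- The curves that stay inside a fixed null set form a family of modulus zero. -/
lemma pqModulus_subset_null (hp : 0 < p) (hq : q ≠ 0) {N : Set X} (hN : MeasurableSet N)
    (hμN : μ N = 0) :
    pqModulus p q μ {γ | ∀ s ∈ Icc 0 γ.length, γ.toFun s ∈ N} = 0 := by
  have h0 : lorentzNorm p q μ (N.indicator fun _ => ∞) = 0 :=
    lorentzNorm_eq_zero_of_ae_eq_zero hp hq
      (measure_mono_null (fun x hx => by_contra fun h => hx (indicator_of_notMem h _)) hμN)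
  rw [pqModulus_eq_zero_iff hp one_pos]
  refine fun ε hε => ⟨N.indicator fun _ => ∞, measurable_const.indicator hN, fun γ hγ => ?_, ?_⟩
  · have : curveIntegral γ (N.indicator fun _ => ∞) = ∫⁻ s in Icc 0 γ.length, ∞ :=
      setLIntegral_congr_fun measurableSet_Icc fun s hs => indicator_of_mem (hγ s hs) _
    rw [this]
    simp [γ.length_pos.not_ge]
  · simpa [h0] using hε

/-- `g` is a weak upper gradient of the `[0, ∞]`-valued function `v`. -/
def IsGradientPair (p : ℝ) (q : ℝ≥0∞) (μ : Measure X) (v g : X → ℝ≥0∞) : Prop :=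
  Measurable v ∧ Measurable g ∧ pqModulus p q μ {γ | ¬ GradientBoundOn v g γ} = 0

lemma IsGradientPair.half_add [SFinite μ] (hp : 0 < p) (hq : q ≠ 0) {v v' g g' : X → ℝ≥0∞}
    (h : IsGradientPair p q μ v g) (h' : IsGradientPair p q μ v' g') :
    IsGradientPair p q μ (fun x => 2⁻¹ * (v x + v' x)) (fun x => 2⁻¹ * (g x + g' x)) := by
  refine ⟨(h.1.add h'.1).const_mul _, (h.2.1.add h'.2.1).const_mul _, ?_⟩
  refine pqModulus_mono_null ?_ (pqModulus_union_null hp hq h.2.2 h'.2.2)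
  intro γ hγ
  by_contra hc
  simp only [mem_union, mem_ofPred_eq, not_or, not_not] at hc
  refine hγ ?_
  obtain ⟨⟨a1, a2, a3⟩, b1, b2, b3⟩ := hc
  -- Only superadditivity of the lower integral is needed, which requires no measurability along the
  -- curve.
  have hI : 2⁻¹ * (curveIntegral γ g + curveIntegral γ g') ≤
      curveIntegral γ (fun x => 2⁻¹ * (g x + g' x)) := by
    rw [curveIntegral, curveIntegral, curveIntegral, lintegral_const_mul' _ _ (by simp)]
    exact mul_le_mul_right (le_lintegral_add _ _) _
  refine ⟨?_, ?_, fun hi => ?_⟩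
  · refine le_trans ?_ (add_le_add_right hI _)
    rw [← mul_add]
    refine mul_le_mul_right ((add_le_add a1 b1).trans_eq ?_) _
    ring
  · refine le_trans ?_ (add_le_add_right hI _)
    rw [← mul_add]
    refine mul_le_mul_right ((add_le_add a2 b2).trans_eq ?_) _
    ring
  · rw [eq_top_iff]
    refine le_trans (le_of_eq ?_) hI
    have : curveIntegral γ g = ∞ ∨ curveIntegral γ g' = ∞ := by
      simp only [ENNReal.mul_eq_top, ENNReal.add_eq_top] at hi
      simp at hi
      tauto
    rcases this with h | h <;> simp [h]

/-- The two inequalities pass to suprema at once. The difficulty is the clause on infinite values: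
if the supremum is infinite at an endpoint while the gradient integral is finite, it is infinite
along the whole curve, which then lies in a null set. Such curves are negligible. -/
lemma IsGradientPair.iSup [SFinite μ] (hp : 0 < p) (hq : q ≠ 0) {v g : ℕ → X → ℝ≥0∞}
    (h : ∀ i, IsGradientPair p q μ (v i) (g i))
    (hfin : lorentzNorm p q μ (fun x => ⨆ i, v i x) < ∞) :
    IsGradientPair p q μ (fun x => ⨆ i, v i x) (fun x => ⨆ i, g i x) := by
  have hv : Measurable fun x => ⨆ i, v i x := Measurable.iSup fun i => (h i).1
  refine ⟨hv, Measurable.iSup fun i => (h i).2.1, ?_⟩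
  have hN := measure_eq_top_eq_zero_of_lorentzNorm_lt_top hp hq hfin
  set N : Set X := {x | ⨆ i, v i x = ∞}
  have hNm : MeasurableSet N := hv (measurableSet_singleton ∞)
  -- Curves with a bad subcurve are discarded too, so that interior points of the remaining curves
  -- can be compared with the endpoints.
  set B : ℕ → Set (RectifiableCurve X) := fun i => {γ | ∃ (a b : ℝ) (ha : 0 ≤ a) (hab : a < b)
    (hb : b ≤ γ.length), ¬ GradientBoundOn (v i) (g i) (γ.restrict ha hab hb)}
  have hB : ∀ i, pqModulus p q μ (B i) = 0 := fun i =>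
    pqModulus_eq_zero_of_forall_exists_le (h i).2.2 fun γ hγ => by
      obtain ⟨a, b, ha, hab, hb, hn⟩ := hγ
      exact ⟨_, hn, γ.curveIntegral_restrict_le ha hab hb⟩
  refine pqModulus_mono_null ?_ (pqModulus_union_null hp hq (pqModulus_iUnion_null hp hq hB)
    (pqModulus_subset_null hp hq hNm hN))
  intro γ hγ
  by_contra hc
  simp only [mem_union, mem_iUnion, mem_ofPred_eq, not_or, not_exists, B, not_not] at hc
  obtain ⟨hc1, hc2⟩ := hc
  refine hγ ?_
  set I := curveIntegral γ fun x => ⨆ i, g i x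
  have hle : ∀ i a b (ha : 0 ≤ a) (hab : a < b) (hb : b ≤ γ.length),
      curveIntegral (γ.restrict ha hab hb) (g i) ≤ I := fun i a b ha hab hb =>
    (γ.curveIntegral_restrict_le ha hab hb _).trans
      (curveIntegral_mono γ fun x => le_iSup (fun i => g i x) i)
  have hsup : ∀ a b, 0 ≤ a → a < b → b ≤ γ.length →
      (⨆ i, v i (γ.toFun a)) ≤ (⨆ i, v i (γ.toFun b)) + I ∧
      (⨆ i, v i (γ.toFun b)) ≤ (⨆ i, v i (γ.toFun a)) + I := by
    intro a b ha hab hb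
    constructor
    · refine iSup_le fun i => ?_
      have h1 := (hc1 i a b ha hab hb).1
      simp only [RectifiableCurve.restrict, add_zero, add_sub_cancel] at h1
      exact h1.trans (add_le_add (le_iSup (fun i => v i (γ.toFun b)) i) (hle i a b ha hab hb))
    · refine iSup_le fun i => ?_
      have h1 := (hc1 i a b ha hab hb).2.1
      simp only [RectifiableCurve.restrict, add_zero, add_sub_cancel] at h1
      exact h1.trans (add_le_add (le_iSup (fun i => v i (γ.toFun a)) i) (hle i a b ha hab hb))
  obtain ⟨e1, e2⟩ := hsup 0 γ.length le_rfl γ.length_pos le_rfl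
  refine ⟨e1, e2, fun hi => ?_⟩
  by_contra hI
  refine hc2 fun s hs => ?_
  show ⨆ i, v i (γ.toFun s) = ∞
  have h0 : ⨆ i, v i (γ.toFun 0) = ∞ := by
    rcases hi with hi | hi
    · exact hi
    · rw [show ⨆ i, v i (γ.toFun γ.length) = ∞ from hi, top_le_iff, ENNReal.add_eq_top] at e2
      exact e2.resolve_right hI
  rcases hs.1.eq_or_lt with rfl | hs0
  · exact h0
  · have := (hsup 0 s le_rfl hs0 hs.2).1
    rw [h0, top_le_iff, ENNReal.add_eq_top] at this
    exact this.resolve_right hI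

end Modulus

/-! ### Uniform convexity estimates -/

section Convexity

/-- By strict convexity the deficit vanishes on `[0, 1]` only at `x = 1`. On the compact set where
`1 - x^s ≥ ε` it has a positive minimum, whose inverse serves as `K`. -/
lemma exists_one_sub_rpow_le {s : ℝ} (hs : 1 < s) {ε : ℝ} (hε : 0 < ε) :
    ∃ K : ℝ, 0 < K ∧ ∀ x ∈ Icc (0 : ℝ) 1,
      1 - x ^ s ≤ ε + K * ((x ^ s + 1) / 2 - ((x + 1) / 2) ^ s) := by
  have hs0 : 0 < s := by linarith
  set φ : ℝ → ℝ := fun x => (x ^ s + 1) / 2 - ((x + 1) / 2) ^ s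
  have hxs : Continuous fun x : ℝ => x ^ s := Real.continuous_rpow_const hs0.le
  have hφ : Continuous φ :=
    ((hxs.add continuous_const).div_const _).sub
      (hxs.comp ((continuous_id.add continuous_const).div_const _))
  have hpos : ∀ x ∈ Icc (0 : ℝ) 1, x ≠ 1 → 0 < φ x := by
    intro x hx hx1
    have h := (strictConvexOn_rpow hs).2 (show x ∈ Ici 0 from hx.1)
      (mem_Ici.2 (zero_le_one' ℝ)) hx1
      (show (0 : ℝ) < 1 / 2 by norm_num) (show (0 : ℝ) < 1 / 2 by norm_num) (by norm_num)
    simp only [smul_eq_mul, Real.one_rpow] at h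
    have h2 : (1 / 2 * x + 1 / 2 * 1 : ℝ) = (x + 1) / 2 := by ring
    rw [h2] at h
    simp only [φ]
    linarith
  have hφ1 : φ 1 = 0 := by simp [φ]
  have hnn : ∀ x ∈ Icc (0 : ℝ) 1, 0 ≤ φ x := by
    intro x hx
    by_cases h : x = 1
    · rw [h, hφ1]
    · exact (hpos x hx h).le
  set T : Set ℝ := Icc 0 1 ∩ {x | ε ≤ 1 - x ^ s}
  have hT : IsCompact T :=
    isCompact_Icc.inter_right (isClosed_le continuous_const (continuous_const.sub hxs))
  have key : ∀ K : ℝ, 0 < K → (∀ x ∈ T, 1 ≤ K * φ x) → ∀ x ∈ Icc (0 : ℝ) 1,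
      1 - x ^ s ≤ ε + K * φ x := by
    intro K hK h x hx
    by_cases hxT : ε ≤ 1 - x ^ s
    · have := h x ⟨hx, hxT⟩
      have := Real.rpow_nonneg hx.1 s
      linarith
    · have := mul_nonneg hK.le (hnn x hx)
      linarith [not_le.1 hxT]
  rcases T.eq_empty_or_nonempty with hE | hne
  · exact ⟨1, one_pos, key 1 one_pos fun x hx => by simp [hE] at hx⟩
  · obtain ⟨y, hy, hmin⟩ := hT.exists_isMinOn hne hφ.continuousOn
    have hy1 : y ≠ 1 := by
      rintro rfl
      have := hy.2
      rw [mem_ofPred_eq, Real.one_rpow] at this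
      linarith
    have hφy := hpos y hy.1 hy1
    refine ⟨(φ y)⁻¹, inv_pos.2 hφy, key _ (inv_pos.2 hφy) fun x hx => ?_⟩
    rw [← div_eq_inv_mul, one_le_div hφy]
    exact hmin hx

/-- A quantitative form of the strict convexity of `x ↦ x ^ s`. -/
lemma exists_rpow_sub_rpow_le {s : ℝ} (hs : 1 < s) {ε : ℝ} (hε : 0 < ε) :
    ∃ K : ℝ, 0 < K ∧ ∀ a b : ℝ≥0∞, b ^ s - a ^ s ≤ ENNReal.ofReal ε * (a ^ s + b ^ s) +
      ENNReal.ofReal K * (2⁻¹ * (a ^ s + b ^ s) - (2⁻¹ * (a + b)) ^ s) := by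
  have hs0 : 0 < s := by linarith
  obtain ⟨K, hK, hle⟩ := exists_one_sub_rpow_le hs hε
  refine ⟨K, hK, fun a b => ?_⟩
  have hε' : ENNReal.ofReal ε ≠ 0 := by simpa using hε
  rcases eq_or_ne a ∞ with rfl | ha
  · simp [hs0, hε']
  rcases eq_or_ne b ∞ with rfl | hb
  · simp [hs0, ENNReal.mul_top hε']
  rcases le_or_gt b a with hba | hab
  · rw [tsub_eq_zero_of_le (ENNReal.rpow_le_rpow hba hs0.le)]
    exact zero_le
  lift a to ℝ≥0 using ha
  lift b to ℝ≥0 using hb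
  have hab' : (a : ℝ) < b := by exact_mod_cast hab
  have hb0 : (0 : ℝ) < b := a.coe_nonneg.trans_lt hab'
  -- By homogeneity the case `a < b` reduces to the ratio `x = a / b`.
  have h1 := hle (a / b) ⟨by positivity, (div_le_one hb0).2 hab'.le⟩
  have hbs : (0 : ℝ) < (b : ℝ) ^ s := Real.rpow_pos_of_pos hb0 s
  have h2 : ((a / b + 1) / 2 : ℝ) = ((a + b) / 2) / b := by field_simp
  rw [h2, Real.div_rpow a.coe_nonneg hb0.le, Real.div_rpow (by positivity) hb0.le] at h1
  have h3 : (b : ℝ) ^ s - a ^ s ≤ ε * b ^ s + K * ((a ^ s + b ^ s) / 2 - ((a + b) / 2) ^ s) := by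
    have := mul_le_mul_of_nonneg_right h1 hbs.le
    field_simp at this
    field_simp
    linarith
  have hK' : ENNReal.ofReal K = (K.toNNReal : ℝ≥0∞) := rfl
  have hε'' : ENNReal.ofReal ε = (ε.toNNReal : ℝ≥0∞) := rfl
  have h2' : (2⁻¹ : ℝ≥0∞) = ((2⁻¹ : ℝ≥0) : ℝ≥0∞) := by simp
  rw [tsub_le_iff_right, hK', hε'', h2']
  simp only [← ENNReal.coe_add, ← ENNReal.coe_mul, ← ENNReal.coe_rpow_of_nonneg _ hs0.le,
    ← ENNReal.coe_sub]
  rw [ENNReal.coe_le_coe, ← NNReal.coe_le_coe]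
  push_cast [NNReal.coe_sub_def]
  rw [Real.coe_toNNReal _ hK.le, Real.coe_toNNReal _ hε.le]
  have h4 : (2⁻¹ * (a + b) : ℝ) = (a + b) / 2 := by ring
  have h5 := mul_le_mul_of_nonneg_left
    (le_max_left (2⁻¹ * ((a : ℝ) ^ s + b ^ s) - (2⁻¹ * (a + b : ℝ)) ^ s) 0) hK.le
  have h6 : 0 ≤ ε * (a : ℝ) ^ s := by positivity
  rw [h4] at h5 ⊢
  nlinarith [h5, h6, h3]

variable {X : Type*} [MeasurableSpace X] {μ : Measure X} [SFinite μ]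

/-- The power of the midpoint plus the convexity deficit is the mean of the powers; `choquet_add_ge`
splits this sum from below and subadditivity bounds it from above. -/
lemma choquet_midpoint_le {θ s : ℝ} (hθ : 0 < θ) (hθ1 : θ ≤ 1) (hs : 1 ≤ s) {f g : X → ℝ≥0∞}
    (hf : Measurable f) (hg : Measurable g) {m : ℝ≥0} (hm : 0 < m) (hm1 : m < 1) :
    ((1 - m : ℝ≥0) : ℝ≥0∞) * choquet μ θ (fun x => (2⁻¹ * (f x + g x)) ^ s) +
      (m : ℝ≥0∞) ^ (1 - θ) * choquet μ θ
        (fun x => 2⁻¹ * (f x ^ s + g x ^ s) - (2⁻¹ * (f x + g x)) ^ s) ≤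
      2⁻¹ * (choquet μ θ (fun x => f x ^ s) + choquet μ θ fun x => g x ^ s) := by
  have hh : Measurable fun x => (2⁻¹ * (f x + g x)) ^ s :=
    ((hf.add hg).const_mul _).pow_const _
  have ha : Measurable fun x => f x ^ s + g x ^ s := (hf.pow_const _).add (hg.pow_const _)
  have hle : ∀ x, (2⁻¹ * (f x + g x)) ^ s ≤ 2⁻¹ * (f x ^ s + g x ^ s) := fun x => by
    have := ENNReal.rpow_arith_mean_le_arith_mean2_rpow 2⁻¹ 2⁻¹ (f x) (g x)
      ENNReal.inv_two_add_inv_two hs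
    simpa only [mul_add] using this
  have heq : (fun x => (2⁻¹ * (f x + g x)) ^ s +
    (2⁻¹ * (f x ^ s + g x ^ s) - (2⁻¹ * (f x + g x)) ^ s)) = fun x => 2⁻¹ * (f x ^ s + g x ^ s) :=
      funext fun x => add_tsub_cancel_of_le (hle x)
  have h2 : (2⁻¹ : ℝ≥0∞) = ENNReal.ofReal 2⁻¹ := by
    rw [ENNReal.ofReal_inv_of_pos two_pos]; simp
  have hadd := choquet_add_ge (μ := μ) hθ hθ1 hh ((ha.const_mul 2⁻¹).sub hh) hm hm1
  refine hadd.trans ((congrArg (choquet μ θ) heq).trans_le ?_)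
  rw [h2, choquet_const_mul _ _ (by norm_num)]
  exact mul_le_mul_right (choquet_add_le hθ hθ1 (hf.pow_const _) (hg.pow_const _)) _

lemma exists_choquet_sub_le {θ s : ℝ} (hθ : 0 < θ) (hθ1 : θ ≤ 1) (hs : 1 < s) {ε : ℝ}
    (hε : 0 < ε) :
    ∃ K : ℝ, 0 < K ∧ ∀ f g : X → ℝ≥0∞, Measurable f → Measurable g →
      choquet μ θ (fun x => g x ^ s - f x ^ s) ≤
        ENNReal.ofReal ε * (choquet μ θ (fun x => f x ^ s) + choquet μ θ fun x => g x ^ s) +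
        ENNReal.ofReal K * choquet μ θ
          (fun x => 2⁻¹ * (f x ^ s + g x ^ s) - (2⁻¹ * (f x + g x)) ^ s) := by
  obtain ⟨K, hK, hle⟩ := exists_rpow_sub_rpow_le hs hε
  refine ⟨K, hK, fun f g hf hg => ?_⟩
  have hh : Measurable fun x => (2⁻¹ * (f x + g x)) ^ s :=
    ((hf.add hg).const_mul _).pow_const _
  have ha : Measurable fun x => f x ^ s + g x ^ s := (hf.pow_const _).add (hg.pow_const _)
  refine (choquet_mono hθ.le fun x => hle (f x) (g x)).trans ?_
  refine (choquet_add_le hθ hθ1 (ha.const_mul _)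
    (((ha.const_mul _).sub hh).const_mul _)).trans ?_
  rw [choquet_const_mul _ _ hε, choquet_const_mul _ _ hK]
  exact add_le_add_left (mul_le_mul_right
    (choquet_add_le hθ hθ1 (hf.pow_const _) (hg.pow_const _)) _) _

/-- Telescoping with positive parts only: every `f n ^ s` is at most `f 0 ^ s` plus the sum of the
positive increments. -/
lemma choquet_iSup_rpow_le {θ s : ℝ} (hθ : 0 < θ) (hθ1 : θ ≤ 1) (hs : 0 < s)
    {f : ℕ → X → ℝ≥0∞} (hf : ∀ i, Measurable (f i)) :
    choquet μ θ (fun x => (⨆ i, f i x) ^ s) ≤ choquet μ θ (fun x => f 0 x ^ s) +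
      ∑' i, choquet μ θ (fun x => f (i + 1) x ^ s - f i x ^ s) := by
  have hd : ∀ i, Measurable fun x => f (i + 1) x ^ s - f i x ^ s := fun i =>
    ((hf _).pow_const _).sub ((hf _).pow_const _)
  refine le_trans (choquet_mono hθ.le (l := fun x => f 0 x ^ s +
    ∑' i, (f (i + 1) x ^ s - f i x ^ s)) fun x => ?_) ((choquet_add_le hθ hθ1
      ((hf 0).pow_const _) (Measurable.tsum hd)).trans
      (add_le_add_right (choquet_tsum_le hθ hθ1 hd) _))
  rw [← ENNReal.le_rpow_inv_iff hs]
  refine iSup_le fun n => ?_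
  rw [ENNReal.le_rpow_inv_iff hs]
  have : f n x ^ s ≤ f 0 x ^ s + ∑ i ∈ Finset.range n, (f (i + 1) x ^ s - f i x ^ s) := by
    induction n with
    | zero => simp
    | succ n ih =>
      rw [Finset.sum_range_succ, ← add_assoc]
      exact le_add_tsub.trans (add_le_add_left ih _)
  exact this.trans (add_le_add_right (ENNReal.sum_le_tsum _) _)

/-- Sequences that are almost minimizing under midpoints are one-sidedly Cauchy. -/
lemma exists_forall_choquet_sub_le {θ s : ℝ} (hθ : 0 < θ) (hθ1 : θ ≤ 1) (hs : 1 < s)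
    {u g : ℕ → X → ℝ≥0∞} (hu : ∀ i, Measurable (u i)) (hg : ∀ i, Measurable (g i))
    {c : ℝ≥0∞} (hc : c ≠ ∞) {w : ℕ → ℝ≥0∞} (hw : Tendsto w atTop (𝓝 c)) (hwc : ∀ i, w i ≤ c)
    (hmid : ∀ i j, i ≤ j → w i ≤ choquet μ θ (fun x => (2⁻¹ * (u i x + u j x)) ^ s) +
      choquet μ θ (fun x => (2⁻¹ * (g i x + g j x)) ^ s))
    (hV : ∀ δ : ℝ≥0∞, 0 < δ → ∀ᶠ i in atTop,
      choquet μ θ (fun x => u i x ^ s) + choquet μ θ (fun x => g i x ^ s) ≤ c + δ)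
    {η : ℝ≥0∞} (hη : 0 < η) :
    ∀ᶠ i in atTop, ∀ j, i ≤ j → choquet μ θ (fun x => u j x ^ s - u i x ^ s) ≤ η ∧
      choquet μ θ (fun x => g j x ^ s - g i x ^ s) ≤ η := by
  obtain ⟨ε, hε, hεη⟩ : ∃ ε : ℝ, 0 < ε ∧ ENNReal.ofReal ε * (2 * (c + 1)) ≤ η / 2 := by
    have h1 : Tendsto (fun ε : ℝ => ENNReal.ofReal ε * (2 * (c + 1))) (𝓝[>] 0) (𝓝 0) := by
      have h2 : Tendsto (fun ε : ℝ => ENNReal.ofReal ε) (𝓝[>] 0) (𝓝 0) := by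
        have := (ENNReal.continuous_ofReal.tendsto 0).mono_left (nhdsWithin_le_nhds (s := Ioi 0))
        simpa using this
      have := ENNReal.Tendsto.mul_const (b := 2 * (c + 1)) h2
        (Or.inr (ENNReal.mul_ne_top (by simp) (by simp [hc])))
      simpa using this
    have h3 := h1.eventually (ge_mem_nhds (ENNReal.half_pos hη.ne'))
    obtain ⟨ε, h4, h5⟩ := (h3.and self_mem_nhdsWithin).exists
    exact ⟨ε, h5, h4⟩
  obtain ⟨K, hK, hKle⟩ := exists_choquet_sub_le (μ := μ) hθ hθ1 hs hε
  -- The order of choice matters: `K` depends on `ε`, and `m` is then taken small in terms of `K`.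
  obtain ⟨m, hm, hm1, hmη⟩ : ∃ m : ℝ≥0, 0 < m ∧ m < 1 ∧
      ENNReal.ofReal K * ((m : ℝ≥0∞) ^ θ * (c + 2)) ≤ η / 2 := by
    have h1 : Tendsto (fun m : ℝ≥0 => ENNReal.ofReal K * ((m : ℝ≥0∞) ^ θ * (c + 2)))
        (𝓝[>] 0) (𝓝 0) := by
      have h2 : Tendsto (fun m : ℝ≥0 => (m : ℝ≥0∞) ^ θ) (𝓝[>] 0) (𝓝 0) := by
        have := (((ENNReal.continuous_rpow_const (y := θ)).comp ENNReal.continuous_coe).tendsto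
          (0 : ℝ≥0)).mono_left (nhdsWithin_le_nhds (s := Ioi 0))
        simpa [Function.comp_def, hθ] using this
      have := ENNReal.Tendsto.const_mul (a := ENNReal.ofReal K)
        (ENNReal.Tendsto.mul_const (b := c + 2) h2 (Or.inr (by simp [hc])))
        (Or.inr ENNReal.ofReal_ne_top)
      simpa using this
    have h3 := h1.eventually (ge_mem_nhds (ENNReal.half_pos hη.ne'))
    have h6 : ∀ᶠ m : ℝ≥0 in 𝓝[>] 0, m < 1 := nhdsWithin_le_nhds (gt_mem_nhds one_pos)
    obtain ⟨m, ⟨h4, h5⟩, h7⟩ := ((h3.and self_mem_nhdsWithin).and h6).exists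
    exact ⟨m, h5, h7, h4⟩
  have hm0 : (m : ℝ≥0∞) ≠ 0 := by simpa using hm.ne'
  have hmt : (m : ℝ≥0∞) ≠ ∞ := ENNReal.coe_ne_top
  have hwm : ∀ᶠ i in atTop, c ≤ w i + m := by
    have := hw.add_const (m : ℝ≥0∞)
    filter_upwards [this.eventually (lt_mem_nhds (ENNReal.lt_add_right hc hm0))] with i hi
    exact hi.le
  have hVm := hV m (by simpa using hm)
  obtain ⟨I, hI⟩ := eventually_atTop.1 hVm
  filter_upwards [hwm, eventually_ge_atTop I] with i hi hiI j hij
  have hVi := hI i hiI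
  have hVj := hI j (hiI.trans hij)
  have hDu := choquet_midpoint_le (μ := μ) hθ hθ1 hs.le (hu i) (hu j) hm hm1
  have hDg := choquet_midpoint_le (μ := μ) hθ hθ1 hs.le (hg i) (hg j) hm hm1
  have hMij := hmid i j hij
  have hKu := hKle (u i) (u j) (hu i) (hu j)
  have hKg := hKle (g i) (g j) (hg i) (hg j)
  generalize choquet μ θ (fun x => (2⁻¹ * (u i x + u j x)) ^ s) = Hu at *
  generalize choquet μ θ (fun x => (2⁻¹ * (g i x + g j x)) ^ s) = Hg at *
  generalize choquet μ θ (fun x => 2⁻¹ * (u i x ^ s + u j x ^ s) - (2⁻¹ * (u i x + u j x)) ^ s) = Eu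
    at *
  generalize choquet μ θ (fun x => 2⁻¹ * (g i x ^ s + g j x ^ s) - (2⁻¹ * (g i x + g j x)) ^ s) = Eg
    at *
  generalize choquet μ θ (fun x => u i x ^ s) = Ui at *
  generalize choquet μ θ (fun x => u j x ^ s) = Uj at *
  generalize choquet μ θ (fun x => g i x ^ s) = Gi at *
  generalize choquet μ θ (fun x => g j x ^ s) = Gj at *
  -- The midpoint energy is at least `w i`, within `m` of `c`, while the mean energy is at most `c +
  -- m`. Comparison leaves `m^(1 - θ) (Eu + Eg) ≤ m (c + 2)`.
  have hE : Eu + Eg ≤ (m : ℝ≥0∞) ^ θ * (c + 2) := by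
    have h1 : ((1 - m : ℝ≥0) : ℝ≥0∞) * w i + (m : ℝ≥0∞) ^ (1 - θ) * (Eu + Eg) ≤ c + m :=
      calc _ ≤ ((1 - m : ℝ≥0) : ℝ≥0∞) * (Hu + Hg) + (m : ℝ≥0∞) ^ (1 - θ) * (Eu + Eg) := by gcongr
        _ = (((1 - m : ℝ≥0) : ℝ≥0∞) * Hu + (m : ℝ≥0∞) ^ (1 - θ) * Eu) +
            (((1 - m : ℝ≥0) : ℝ≥0∞) * Hg + (m : ℝ≥0∞) ^ (1 - θ) * Eg) := by ring
        _ ≤ 2⁻¹ * (Ui + Uj) + 2⁻¹ * (Gi + Gj) := add_le_add hDu hDg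
        _ = 2⁻¹ * ((Ui + Gi) + (Uj + Gj)) := by ring
        _ ≤ 2⁻¹ * ((c + m) + (c + m)) := by gcongr
        _ = c + m := by
          rw [mul_add, ← add_mul, ENNReal.inv_two_add_inv_two, one_mul]
    have h2 : c + m ≤ ((1 - m : ℝ≥0) : ℝ≥0∞) * w i + m * (c + 2) :=
      calc c + m ≤ w i + m + m := by gcongr
        _ = (((1 - m : ℝ≥0) : ℝ≥0∞) + m) * w i + m + m := by
          rw [← ENNReal.coe_add, tsub_add_cancel_of_le hm1.le, ENNReal.coe_one, one_mul]
        _ = ((1 - m : ℝ≥0) : ℝ≥0∞) * w i + m * (w i + 2) := by ring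
        _ ≤ _ := by gcongr; exact hwc i
    have hfin : ((1 - m : ℝ≥0) : ℝ≥0∞) * w i ≠ ∞ :=
      ENNReal.mul_ne_top ENNReal.coe_ne_top (ne_top_of_le_ne_top hc (hwc i))
    have h3 := (ENNReal.add_le_add_iff_left hfin).1 (h1.trans h2)
    calc Eu + Eg = (m : ℝ≥0∞) ^ (θ - 1) * ((m : ℝ≥0∞) ^ (1 - θ) * (Eu + Eg)) := by
          rw [← mul_assoc, ← ENNReal.rpow_add _ _ hm0 hmt]
          simp
      _ ≤ (m : ℝ≥0∞) ^ (θ - 1) * (m * (c + 2)) := by gcongr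
      _ = _ := by
          rw [← mul_assoc]
          congr 1
          conv_lhs => enter [2]; rw [← ENNReal.rpow_one (m : ℝ≥0∞)]
          rw [← ENNReal.rpow_add _ _ hm0 hmt, sub_add_cancel]
  have hm1' : (m : ℝ≥0∞) ≤ 1 := by exact_mod_cast hm1.le
  have hfinal : ∀ A B E : ℝ≥0∞, A ≤ c + m → B ≤ c + m → E ≤ Eu + Eg →
      ENNReal.ofReal ε * (A + B) + ENNReal.ofReal K * E ≤ η := by
    intro A B E hA hB hEE
    calc _ ≤ ENNReal.ofReal ε * (2 * (c + 1)) + ENNReal.ofReal K * ((m : ℝ≥0∞) ^ θ * (c + 2)) := by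
          rw [two_mul]
          gcongr
          · exact hA.trans (by gcongr)
          · exact hB.trans (by gcongr)
          · exact hEE.trans hE
      _ ≤ η / 2 + η / 2 := add_le_add hεη hmη
      _ = η := ENNReal.add_halves η
  exact ⟨hKu.trans (hfinal _ _ _ (le_self_add.trans hVi) (le_self_add.trans hVj) le_self_add),
    hKg.trans (hfinal _ _ _ (le_add_self.trans hVi) (le_add_self.trans hVj) le_add_self)⟩

end Convexity

/-! ### Subadditivity and continuity of the capacity -/

section Capacity

lemma measurable_abs_ereal : Measurable EReal.abs := by
  have : EReal.abs = fun x : EReal => max x.toENNReal (-x).toENNReal := by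
    ext x
    induction x with
    | bot => simp
    | top => simp
    | coe a =>
      rw [EReal.abs_def, ← EReal.coe_neg, EReal.toENNReal_of_ne_top (EReal.coe_ne_top _),
        EReal.toENNReal_of_ne_top (EReal.coe_ne_top _), EReal.toReal_coe, EReal.toReal_coe,
        ← ENNReal.ofReal_max, abs_eq_max_neg]
  rw [this]
  exact measurable_ereal_toENNReal.max
    (measurable_ereal_toENNReal.comp continuous_neg.measurable)

lemma le_abs_of_one_le {x : EReal} (h : 1 ≤ x) : 1 ≤ x.abs := by
  induction x with
  | bot => exact absurd (le_bot_iff.1 h) (EReal.coe_ne_bot 1)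
  | top => simp
  | coe a =>
    rw [EReal.abs_def, ← ENNReal.ofReal_one]
    exact ENNReal.ofReal_le_ofReal (le_trans (by exact_mod_cast h) (le_abs_self a))

variable {X : Type*} [MetricSpace X] [MeasurableSpace X] {μ : Measure X} {p : ℝ} {q : ℝ≥0∞}

lemma newtonianNorm_eq (u : X → EReal) :
    newtonianNorm p q μ u = (lorentzNorm p q μ (absFun u) ^ newtonianExponent p q +
      ⨅ (g : X → ℝ≥0∞) (_ : IsWeakUpperGradient p q μ u g) (_ : lorentzNorm p q μ g < ∞),
        lorentzNorm p q μ g ^ newtonianExponent p q) ^ (1 / newtonianExponent p q) := by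
  unfold newtonianNorm newtonianExponent
  split_ifs <;> rfl

lemma capacity_rpow_le (hp : 0 < p) (hq : q ≠ 0) {E : Set X} {v g : X → ℝ≥0∞}
    (h : IsGradientPair p q μ v g) (hE : ∀ x ∈ E, 1 ≤ v x) :
    capacity p q μ E ^ (newtonianExponent p q / p) ≤
      lorentzNorm p q μ v ^ newtonianExponent p q + lorentzNorm p q μ g ^ newtonianExponent p q := by
  have hr := newtonianExponent_pos hp hq
  rcases eq_or_ne (lorentzNorm p q μ v) ∞ with hv | hv
  · simp [hv, hr]
  rcases eq_or_ne (lorentzNorm p q μ g) ∞ with hg | hg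
  · simp [hg, hr]
  set u : X → EReal := fun x => (v x : EReal)
  have habs : absFun u = v := funext fun x => abs_coe_ennreal (v x)
  have hsub : {γ | ¬ UpperGradientOn u g γ} ⊆ {γ | ¬ GradientBoundOn v g γ} :=
    fun γ (hγ : ¬ UpperGradientOn u g γ) (hc : GradientBoundOn v g γ) => hγ hc.upperGradientOn
  have hug : IsWeakUpperGradient p q μ u g := ⟨h.2.1, pqModulus_mono_null hsub h.2.2⟩
  have hu : u ∈ admissible p q μ E := by
    refine ⟨⟨h.1.coe_ereal_ennreal, by rw [habs]; exact hv.lt_top, g, hug, hg.lt_top⟩, ?_⟩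
    intro x hx
    change (1 : EReal) ≤ (v x : EReal)
    exact_mod_cast hE x hx
  have h1 : capacity p q μ E ≤ newtonianNorm p q μ u ^ p := iInf₂_le u hu
  calc capacity p q μ E ^ (newtonianExponent p q / p)
      ≤ (newtonianNorm p q μ u ^ p) ^ (newtonianExponent p q / p) :=
        ENNReal.rpow_le_rpow h1 (div_pos hr hp).le
    _ = newtonianNorm p q μ u ^ newtonianExponent p q := by
        rw [← ENNReal.rpow_mul, mul_div_cancel₀ _ hp.ne']
    _ ≤ _ := by
        rw [newtonianNorm_eq, one_div, ENNReal.rpow_inv_rpow hr.ne', habs]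
        gcongr
        exact iInf_le_of_le g (iInf_le_of_le hug (iInf_le _ hg.lt_top))

lemma exists_isGradientPair_of_capacity_lt (hp : 0 < p) (hq : q ≠ 0) {E : Set X} {b : ℝ≥0∞}
    (hb : capacity p q μ E ^ (newtonianExponent p q / p) < b) :
    ∃ v g : X → ℝ≥0∞, IsGradientPair p q μ v g ∧ (∀ x ∈ E, 1 ≤ v x) ∧
      lorentzNorm p q μ v ^ newtonianExponent p q + lorentzNorm p q μ g ^ newtonianExponent p q < b := by
  have hr := newtonianExponent_pos hp hq
  set r := newtonianExponent p q
  have h1 : capacity p q μ E < b ^ (p / r) := by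
    have := ENNReal.rpow_lt_rpow hb (div_pos hp hr)
    rwa [← ENNReal.rpow_mul, div_mul_div_cancel₀ hp.ne', div_self hr.ne', ENNReal.rpow_one] at this
  simp only [capacity, iInf_lt_iff] at h1
  obtain ⟨u, ⟨⟨hum, huf, -⟩, huE⟩, hlt⟩ := h1
  have h2 : newtonianNorm p q μ u ^ r < b := by
    have := ENNReal.rpow_lt_rpow hlt (div_pos hr hp)
    rwa [← ENNReal.rpow_mul, ← ENNReal.rpow_mul, mul_div_cancel₀ _ hp.ne',
      div_mul_div_cancel₀ hr.ne', div_self hp.ne', ENNReal.rpow_one] at this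
  rw [newtonianNorm_eq, one_div, ENNReal.rpow_inv_rpow hr.ne'] at h2
  rw [← lt_tsub_iff_left] at h2
  simp only [iInf_lt_iff] at h2
  obtain ⟨g, hg, -, hgb⟩ := h2
  have hsub : {γ | ¬ GradientBoundOn (absFun u) g γ} ⊆ {γ | ¬ UpperGradientOn u g γ} :=
    fun γ (hγ : ¬ GradientBoundOn (absFun u) g γ) (hc : UpperGradientOn u g γ) =>
      hγ hc.gradientBoundOn
  refine ⟨absFun u, g, ⟨measurable_abs_ereal.comp hum, hg.1, pqModulus_mono_null hsub hg.2⟩,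
    fun x hx => le_abs_of_one_le (huE x hx),
    lt_tsub_iff_left.1 hgb⟩

lemma capacity_mono {E₁ E₂ : Set X} (h : E₁ ⊆ E₂) : capacity p q μ E₁ ≤ capacity p q μ E₂ :=
  iInf_le_iInf_of_subset fun _ hu => ⟨hu.1, fun x hx => hu.2 x (h hx)⟩

lemma capacity_iUnion_rpow_le [SFinite μ] (hp : 0 < p) (hq : q ≠ 0) (E : ℕ → Set X) :
    capacity p q μ (⋃ i, E i) ^ (newtonianExponent p q / p) ≤
      ∑' i, capacity p q μ (E i) ^ (newtonianExponent p q / p) := by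
  have hr := newtonianExponent_pos hp hq
  by_cases hfin : ∑' i, capacity p q μ (E i) ^ (newtonianExponent p q / p) = ∞
  · rw [hfin]; exact le_top
  refine ENNReal.le_of_forall_pos_le_add fun ε hε _ => ?_
  obtain ⟨δ, hδ, hsum⟩ := ENNReal.exists_pos_sum_of_countable' (ENNReal.coe_pos.2 hε).ne' ℕ
  choose v g hvg hvE hlt using fun i => exists_isGradientPair_of_capacity_lt (E := E i) hp hq
    (ENNReal.lt_add_right (ENNReal.ne_top_of_tsum_ne_top hfin i) (hδ i).ne')
  have hbound := (add_le_add (lorentzNorm_iSup_rpow_le (μ := μ) hp hq fun i => (hvg i).1)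
    (lorentzNorm_iSup_rpow_le (μ := μ) hp hq fun i => (hvg i).2.1)).trans_eq ENNReal.tsum_add.symm
  have hbound' := (hbound.trans (ENNReal.tsum_le_tsum fun i => (hlt i).le)).trans_eq
    ENNReal.tsum_add
  have hbound'' := hbound'.trans (add_le_add_right hsum.le _)
  have hvfin : lorentzNorm p q μ (fun x => ⨆ i, v i x) < ∞ := by
    rw [← ENNReal.rpow_lt_top_iff_of_pos hr]
    exact (le_self_add.trans hbound'').trans_lt
      (ENNReal.add_lt_top.2 ⟨lt_top_iff_ne_top.2 hfin, ENNReal.coe_lt_top⟩)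
  refine (capacity_rpow_le hp hq (IsGradientPair.iSup hp hq hvg hvfin) fun x hx => ?_).trans
    hbound''
  obtain ⟨i, hi⟩ := mem_iUnion.1 hx
  exact (hvE i x hi).trans (le_iSup (fun i => v i x) i)

/-- Continuity of the capacity along increasing sequences. -/
lemma capacity_iUnion_rpow_le_iSup [SFinite μ] (hp : 0 < p) (hq1 : 1 < q)
    (hqp : q ≤ ENNReal.ofReal p) (E : ℕ → Set X) (hE : Monotone E) :
    capacity p q μ (⋃ i, E i) ^ (newtonianExponent p q / p) ≤
      ⨆ i, capacity p q μ (E i) ^ (newtonianExponent p q / p) := by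
  have hq : q ≠ 0 := (zero_lt_one.trans hq1).ne'
  have hqt : q ≠ ∞ := (hqp.trans_lt ENNReal.ofReal_lt_top).ne
  have hre : newtonianExponent p q = q.toReal := if_pos hqp
  have hr := newtonianExponent_pos hp hq
  rw [hre] at hr
  have hs : 1 < q.toReal := by
    rwa [← ENNReal.toReal_one, ENNReal.toReal_lt_toReal ENNReal.one_ne_top hqt]
  set s := q.toReal
  set θ := s / p
  rw [hre]
  set W : Set X → ℝ≥0∞ := fun A => capacity p q μ A ^ θ
  have hθ : 0 < θ := div_pos hr hp
  have hθ1 : θ ≤ 1 := (div_le_one hp).2 (ENNReal.toReal_le_of_le_ofReal hp.le hqp)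
  have hκ0 : ENNReal.ofReal θ ≠ 0 := by simpa using hθ
  have hκt : ENNReal.ofReal θ ≠ ∞ := ENNReal.ofReal_ne_top
  have hnorm : ∀ f : X → ℝ≥0∞, choquet μ θ (fun x => f x ^ s) =
      ENNReal.ofReal θ * lorentzNorm p q μ f ^ s := fun f => by
    rw [lorentzNorm_rpow_toReal hp hq hqt, ENNReal.mul_div_cancel hκ0 hκt]
  generalize hκ : ENNReal.ofReal θ = κ at *
  have hWmono : Monotone fun i => W (E i) := fun i j hij =>
    ENNReal.rpow_le_rpow (capacity_mono (hE hij)) hθ.le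
  set w := ⨆ i, W (E i)
  change W (⋃ i, E i) ≤ w
  rcases eq_or_ne w ∞ with hwt | hwt
  · rw [hwt]; exact le_top
  have hWw : ∀ i, W (E i) ≤ w := fun i => le_iSup (fun i => W (E i)) i
  have hlim0 : Tendsto (fun i : ℕ => ((i : ℝ≥0∞) + 1)⁻¹) atTop (𝓝 0) := by
    have := ENNReal.tendsto_inv_nat_nhds_zero.comp (tendsto_add_atTop_nat 1)
    refine this.congr fun i => by simp
  choose u g hug huE hlt using fun i : ℕ => exists_isGradientPair_of_capacity_lt (E := E i) hp hq
    (ENNReal.lt_add_right (ne_top_of_le_ne_top hwt (by rw [hre]; exact hWw i))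
      (show ((i : ℝ≥0∞) + 1)⁻¹ ≠ 0 by simp))
  rw [hre] at hlt
  have hV : ∀ δ : ℝ≥0∞, 0 < δ → ∀ᶠ i in atTop,
      choquet μ θ (fun x => u i x ^ s) + choquet μ θ (fun x => g i x ^ s) ≤ κ * w + δ := by
    intro δ hδ
    have h1 : Tendsto (fun i : ℕ => κ * ((i : ℝ≥0∞) + 1)⁻¹) atTop (𝓝 0) := by
      simpa using ENNReal.Tendsto.const_mul hlim0 (Or.inr hκt)
    filter_upwards [h1.eventually (gt_mem_nhds hδ)] with i hi
    rw [hnorm, hnorm, ← mul_add]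
    calc _ ≤ κ * (W (E i) + ((i : ℝ≥0∞) + 1)⁻¹) := mul_le_mul_right (hlt i).le _
      _ = κ * W (E i) + κ * ((i : ℝ≥0∞) + 1)⁻¹ := mul_add _ _ _
      _ ≤ _ := add_le_add (mul_le_mul_right (hWw i) _) hi.le
  -- Since `E i ⊆ E j`, both functions are at least `1` on `E i`, and so is their midpoint.
  have hmid : ∀ i j, i ≤ j → κ * W (E i) ≤
      choquet μ θ (fun x => (2⁻¹ * (u i x + u j x)) ^ s) +
        choquet μ θ (fun x => (2⁻¹ * (g i x + g j x)) ^ s) := by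
    intro i j hij
    rw [hnorm, hnorm, ← mul_add]
    have h := capacity_rpow_le (E := E i) hp hq ((hug i).half_add hp hq (hug j)) fun x hx => by
      calc (1 : ℝ≥0∞) = 2⁻¹ * (1 + 1) := by
            rw [mul_add, mul_one, ENNReal.inv_two_add_inv_two]
        _ ≤ _ := by
            gcongr
            exacts [huE i x hx, huE j x (hE hij hx)]
    rw [hre] at h
    exact mul_le_mul_right h _
  have hWlim : Tendsto (fun i => κ * W (E i)) atTop (𝓝 (κ * w)) :=
    ENNReal.Tendsto.const_mul (tendsto_atTop_iSup hWmono) (Or.inr hκt)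
  have hcauchy : ∀ η : ℝ≥0∞, 0 < η → _ := fun η hη =>
    exists_forall_choquet_sub_le (μ := μ) hθ hθ1 hs (fun i => (hug i).1) (fun i => (hug i).2.1)
      (ENNReal.mul_ne_top hκt hwt) hWlim (fun i => mul_le_mul_right (hWw i) _) hmid
      (fun δ hδ => hV δ (by exact_mod_cast hδ)) hη
  suffices hmain : ∀ ε : ℝ≥0, 0 < ε → κ * W (⋃ i, E i) ≤ κ * w + (ε + (ε + ε)) by
    have h1 : κ * W (⋃ i, E i) ≤ κ * w := by
      refine ENNReal.le_of_forall_pos_le_add fun ε hε _ => (hmain (ε / 3) (by positivity)).trans ?_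
      gcongr
      rw [← ENNReal.coe_add, ← ENNReal.coe_add, ENNReal.coe_le_coe]
      apply le_of_eq
      ring
    exact (ENNReal.mul_le_mul_iff_right hκ0 hκt).1 h1
  intro ε hε
  obtain ⟨η, hη, hsum⟩ := ENNReal.exists_pos_sum_of_countable' (ENNReal.coe_pos.2 hε).ne' ℕ
  choose I hI using fun k => eventually_atTop.1 (hcauchy (η k) (hη k))
  obtain ⟨J, hJ⟩ := eventually_atTop.1 (hV ε (by exact_mod_cast hε))
  -- The summand `J` makes the first energy almost `κ * w`, the summand `k` gives `n k ≥ k` so that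
  -- all sets are reached, and the sum makes `n` monotone with `n k ≥ I k`.
  set n : ℕ → ℕ := fun k => J + k + ∑ i ∈ Finset.range (k + 1), I i
  have hnI : ∀ k, I k ≤ n k := fun k =>
    (Finset.single_le_sum (f := I) (fun _ _ => Nat.zero_le _) (Finset.self_mem_range_succ k)).trans
      (Nat.le_add_left _ _)
  have hnmono : ∀ k, n k ≤ n (k + 1) := fun k => by
    simp only [n, Finset.sum_range_succ _ (k + 1)]
    omega
  have hu := choquet_iSup_rpow_le (μ := μ) hθ hθ1 hr (f := fun k => u (n k)) fun k => (hug _).1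
  have hg := choquet_iSup_rpow_le (μ := μ) hθ hθ1 hr (f := fun k => g (n k)) fun k => (hug _).2.1
  have hu' := hu.trans (add_le_add_right ((ENNReal.tsum_le_tsum fun k =>
    (hI k (n k) (hnI k) _ (hnmono k)).1).trans hsum.le) _)
  have hg' := hg.trans (add_le_add_right ((ENNReal.tsum_le_tsum fun k =>
    (hI k (n k) (hnI k) _ (hnmono k)).2).trans hsum.le) _)
  have hV0 := hJ (n 0) (by simp only [n]; omega)
  -- One `ε` comes from the starting energy, and one each from the increments of the functions and
  -- of the gradients.
  have htotal : choquet μ θ (fun x => (⨆ k, u (n k) x) ^ s) +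
      choquet μ θ (fun x => (⨆ k, g (n k) x) ^ s) ≤ κ * w + (ε + (ε + ε)) := by
    refine (add_le_add hu' hg').trans ?_
    rw [add_add_add_comm, ← add_assoc (κ * w)]
    exact add_le_add_left hV0 _
  rw [hnorm, hnorm, ← mul_add] at htotal
  refine le_trans (mul_le_mul_right ?_ _) htotal
  have hfin : lorentzNorm p q μ (fun x => ⨆ k, u (n k) x) < ∞ := by
    rw [lt_top_iff_ne_top]
    intro h
    rw [h, ENNReal.top_rpow_of_pos hr, top_add, ENNReal.mul_top hκ0, top_le_iff] at htotal
    exact absurd htotal (by finiteness)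
  have h := capacity_rpow_le (E := ⋃ i, E i) hp hq
    (IsGradientPair.iSup hp hq (fun k => hug (n k)) hfin) fun x hx => by
      obtain ⟨i, hi⟩ := mem_iUnion.1 hx
      have hin : i ≤ n i := by simp only [n]; omega
      exact (huE (n i) x (hE hin hi)).trans (le_iSup (fun k => u (n k) x) i)
  rw [hre] at h
  exact h

/-- Balls of integer radii about a fixed point exhaust the space; σ-finiteness is what the uses of
Fubini require. -/
lemma sigmaFinite_of_isBounded_lt_top [OpensMeasurableSpace X]
    (h : ∀ U : Set X, IsOpen U → U.Nonempty → Bornology.IsBounded U → 0 < μ U ∧ μ U < ∞) :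
    SigmaFinite μ := by
  rcases isEmpty_or_nonempty X with hX | ⟨⟨x⟩⟩
  · have : μ = 0 := Measure.eq_zero_of_isEmpty μ
    rw [this]
    infer_instance
  · refine ⟨⟨⟨fun n => Metric.ball x (n + 1), fun _ => trivial, fun n =>
      (h _ Metric.isOpen_ball ⟨x, Metric.mem_ball_self (by positivity)⟩ Metric.isBounded_ball).2,
      ?_⟩⟩⟩
    refine eq_univ_of_forall fun y => mem_iUnion.2 ?_
    obtain ⟨n, hn⟩ := exists_nat_gt (dist y x)
    exact ⟨n, Metric.mem_ball.2 (by linarith)⟩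

end Capacity

end SobolevLorentz

theorem mainTheorem7 {X : Type*} [MetricSpace X] [CompleteSpace X] [MeasurableSpace X]
    [BorelSpace X] (μ : Measure X) (hμ : μ ≠ 0)
    (hball : ∀ U : Set X, IsOpen U → U.Nonempty → Bornology.IsBounded U → 0 < μ U ∧ μ U < ∞)
    (p : ℝ) (hp : 1 < p) (q : ℝ≥0∞) (hq : 1 ≤ q) :
    (∀ E₁ E₂ : Set X, E₁ ⊆ E₂ →
      SobolevLorentz.capacity p q μ E₁ ≤ SobolevLorentz.capacity p q μ E₂) ∧
    (SobolevLorentz.IsNonatomic μ → 1 < q → q ≤ ENNReal.ofReal p →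
      ∀ E : ℕ → Set X, (∀ i, E i ⊆ E (i + 1)) →
        Tendsto (fun i => SobolevLorentz.capacity p q μ (E i)) atTop
          (𝓝 (SobolevLorentz.capacity p q μ (⋃ i, E i)))) ∧
    (ENNReal.ofReal p < q →
      ∀ E : ℕ → Set X,
        SobolevLorentz.capacity p q μ (⋃ i, E i) ≤
          ∑' i, SobolevLorentz.capacity p q μ (E i)) ∧
    (q ≤ ENNReal.ofReal p →
      ∀ E : ℕ → Set X,
        SobolevLorentz.capacity p q μ (⋃ i, E i) ^ (q.toReal / p) ≤
          ∑' i, SobolevLorentz.capacity p q μ (E i) ^ (q.toReal / p)) := by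
  have hp0 : 0 < p := by linarith
  have hq0 : q ≠ 0 := (zero_lt_one.trans_le hq).ne'
  have : SigmaFinite μ := SobolevLorentz.sigmaFinite_of_isBounded_lt_top hball
  refine ⟨fun E₁ E₂ h => SobolevLorentz.capacity_mono h, fun _ hq1 hqp E hE => ?_, fun hpq E => ?_,
    fun hqp E => ?_⟩
  · have hmono : Monotone E := monotone_nat_of_le_succ hE
    have h := SobolevLorentz.capacity_iUnion_rpow_le_iSup (μ := μ) hp0 hq1 hqp E hmono
    have hr : 0 < SobolevLorentz.newtonianExponent p q / p :=
      div_pos (SobolevLorentz.newtonianExponent_pos hp0 hq0) hp0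
    have hlim : Tendsto (fun i => SobolevLorentz.capacity p q μ (E i)) atTop
        (𝓝 (⨆ i, SobolevLorentz.capacity p q μ (E i))) :=
      tendsto_atTop_iSup fun i j hij => SobolevLorentz.capacity_mono (hmono hij)
    convert hlim using 2
    refine le_antisymm ?_ (iSup_le fun i => SobolevLorentz.capacity_mono (subset_iUnion E i))
    rw [← ENNReal.rpow_le_rpow_iff hr]
    exact h.trans (iSup_le fun i => ENNReal.rpow_le_rpow
      (le_iSup (fun i => SobolevLorentz.capacity p q μ (E i)) i) hr.le)
  · have h := SobolevLorentz.capacity_iUnion_rpow_le (μ := μ) hp0 hq0 E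
    rw [SobolevLorentz.newtonianExponent, if_neg (not_le.2 hpq), div_self hp0.ne'] at h
    simpa only [ENNReal.rpow_one] using h
  · have h := SobolevLorentz.capacity_iUnion_rpow_le (μ := μ) hp0 hq0 E
    rwa [SobolevLorentz.newtonianExponent, if_pos hqp] at h
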